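/- Let $R$ be a commutative ring and let $F(x,y)=x+y+\sum_{i,j\ge1}a_{ij}x^iy^j$ be a one-dimensional commutative formal group law over $R$ such that $a=a_{11}$ is invertible in $R$. Let $\imath_F(x)$ be the formal inverse, $F(x,\imath_F(x))=0$, and put $\mu_F(x)=\imath_F(x)/(-x)$, $\kappa^F(x)=\frac1x+\frac1{\imath_F(x)}$ and $h(x)=(\imath_F(x)+x)/x$; these are power series, and $h(x)=ax+\cdots$ has a composition inverse $f$. Let $\tilde F(x,y)=h(F(f(x),f(y)))$ be the normalization of $F$, again a formal group law over $R$. Let $\Lambda$ be the lattice of a root datum with finite set of roots $\Sigma\subset\Lambda$, Weyl group $W$ and simple roots $\alpha_i$; let $s_\alpha$ be the reflection in $\alpha$ and $s_i=s_{\alpha_i}$. For a formal group law $G$ over a commutative ring $S$, let $S[\![x_\Lambda]\!]$ be the completion of the polynomial ring $S[x_\lambda\mid\lambda\in\Lambda]$ at the kernel of $x_\lambda\mapsto0$, and let $S[\![\Lambda]\!]_G$ be its quotient by the closure of the ideal generated by $x_0$ and all $x_{\lambda+\lambda'}-G(x_\lambda,x_{\lambda'})$. The group $W$ acts on it by $w(x_\lambda)=x_{w(\lambda)}$.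 Let $Q^F=R[\![\Lambda]\!]_F[\frac1{x_\alpha}\mid\alpha\in\Sigma]$, and let $Q^F_W=Q^F\sharp_R R[W]$ be the twisted group algebra, free over $Q^F$ on $\{\delta_w\}_{w\in W}$ with $q\delta_w\cdot q'\delta_{w'}=q\,w(q')\,\delta_{ww'}$. The formal affine Demazure algebra $\mathbf D_F$ is the $R$-subalgebra of $Q^F_W$ generated by $R[\![\Lambda]\!]_F$ and the elements $X_\alpha=\frac1{x_\alpha}(1-\delta_{s_\alpha})$, $\alpha\in\Sigma$. Let $\Gamma$ be a free abelian group of rank $1$ with generator $\gamma$, let $R_F=R[\![\Gamma]\!]_F$, and view $F$ as a formal group law over $R_F$. Put $\Theta_F=\mu_F(x_\gamma)-\mu_F(x_{-\gamma})\in R_F$, $\kappa_\alpha=\kappa^F(x_\alpha)$, $(Q^F)'=R_F[\![\Lambda]\!]_F[\frac1{\kappa_\alpha}\mid\alpha\in\Sigma][\frac1{x_\alpha}\mid\alpha\in\Sigma]$ and $(Q_W^F)'=(Q^F)'\sharp_{R_F}R_F[W]$. The formal affine Hecke algebra $\mathbf H_F$ is the $R_F$-subalgebra of $(Q_W^F)'$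 generated by $R_F[\![\Lambda]\!]_F[\frac1{\kappa_\alpha}\mid\alpha\in\Sigma]$ and the elements $T_i^F=\frac{\Theta_F}{\kappa_{\alpha_i}}\cdot\frac1{x_{\alpha_i}}(1-\delta_{s_i})+\mu_F(x_\gamma)\delta_{s_i}$. (If $R\ne0$, then $\kappa^F\neq0$ and $\kappa^{\tilde F}\ne0$. If $R=0$, all algebras below are zero.) The same definitions are used for $\tilde F$. Then the following hold. (1) There is a ring isomorphism $\phi_f:R[\![\Lambda]\!]_F\to R[\![\Lambda]\!]_{\tilde F}$, $R$-linear and a homeomorphism, with $\phi_f(x_\lambda)=f(x_\lambda)$ for all $\lambda\in\Lambda$. It extends to a ring isomorphism $Q_W^F\to Q_W^{\tilde F}$ with $u\delta_w\mapsto\phi_f(u)\delta_w$ for $u\in R[\![\Lambda]\!]_F$ and $w\in W$, which restricts to a ring isomorphism $\mathbf D_F\cong\mathbf D_{\tilde F}$. (2) There are ring isomorphisms $\phi_f:R_F[\![\Lambda]\!]_F\to R_{\tilde F}[\![\Lambda]\!]_{\tilde F}$ and $\imath_{\tilde F}:R_{\tilde F}[\![\Lambda]\!]_{\tilde F}\to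 R_{\tilde F}[\![\Lambda]\!]_{\tilde F}$, both homeomorphisms, given by $x_\lambda\mapsto f(x_\lambda)$ and $x_\lambda\mapsto\imath_{\tilde F}(x_\lambda)$ for $\lambda\in\Lambda$, and on coefficients by the continuous $R$-algebra isomorphisms $R_F\to R_{\tilde F}$ and $R_{\tilde F}\to R_{\tilde F}$ given by $x_\nu\mapsto f(x_\nu)$ and $x_\nu\mapsto\imath_{\tilde F}(x_\nu)$ for $\nu\in\Gamma$. The composite $\imath_{\tilde F}\circ\phi_f$ extends to a ring isomorphism $(Q_W^F)'\to(Q_W^{\tilde F})'$ with $u\delta_w\mapsto\imath_{\tilde F}(\phi_f(u))\delta_w$ for $u\in R_F[\![\Lambda]\!]_F$ and $w\in W$, which restricts to a ring isomorphism $\mathbf H_F\cong\mathbf H_{\tilde F}$ and sends $T_i^F$ to $T_i^{\tilde F}$ for every simple root $\alpha_i$. -/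

import Mathlib

noncomputable section

namespace FormalHecke

variable {R : Type*} [CommRing R]

section FormalGroupLaws

open MvPowerSeries Finsupp

theorem coeff_single_subst_zero (G : MvPowerSeries (Fin 2) R) (k : ℕ) :
    PowerSeries.coeff k (G.subst ![(PowerSeries.X : PowerSeries R), 0]) = G.coeff (single 0 k) := by
  have hs : HasSubst ![(PowerSeries.X : PowerSeries R), 0] := HasSubst.X_zero
  rw [PowerSeries.coeff, coeff_subst hs, finsum_eq_single _ (single 0 k)]
  · simp [← PowerSeries.coeff_def, PowerSeries.coeff_X_pow]
  · intro d hd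
    by_cases h1 : d 1 = 0
    · have : d 0 ≠ k := by
        rintro rfl
        exact hd (by ext i; fin_cases i <;> simp [h1])
      simp [h1, ← PowerSeries.coeff_def, PowerSeries.coeff_X_pow, this.symm]
    · simp [h1]

theorem coeff_zero_subst_single (G : MvPowerSeries (Fin 2) R) (k : ℕ) :
    PowerSeries.coeff k (G.subst ![0, (PowerSeries.X : PowerSeries R)]) = G.coeff (single 1 k) := by
  have hs : HasSubst ![0, (PowerSeries.X : PowerSeries R)] := HasSubst.zero_X
  rw [PowerSeries.coeff, coeff_subst hs, finsum_eq_single _ (single 1 k)]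
  · simp [← PowerSeries.coeff_def, PowerSeries.coeff_X_pow]
  · intro d hd
    by_cases h1 : d 0 = 0
    · have : d 1 ≠ k := by
        rintro rfl
        exact hd (by ext i; fin_cases i <;> simp [h1])
      simp [h1, ← PowerSeries.coeff_def, PowerSeries.coeff_X_pow, this.symm]
    · simp [h1]

/-- The series `∑_{i, j ≥ 1} a_{ij} x^{i-1} y^{j-1}` attached to `F`. -/
def mixedPart (F : FormalGroup R) : MvPowerSeries (Fin 2) R :=
  fun m => F.toPowerSeries.coeff (m + (single 0 1 + single 1 1))

/-- The coefficient `a = a₁₁` of `x y` in `F(x, y)`. -/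
def a₁₁ (F : FormalGroup R) : R := F.toPowerSeries.coeff (single 0 1 + single 1 1)

theorem eq_add_mixedPart (F : FormalGroup R) :
    F.toPowerSeries = X 0 + X 1 + X 0 * X 1 * mixedPart F := by
  have hmon : (X 0 * X 1 : MvPowerSeries (Fin 2) R) = monomial (single 0 1 + single 1 1) 1 := by
    simp [X, monomial_mul_monomial]
  ext m
  rw [hmon, map_add, map_add, coeff_monomial_mul]
  by_cases h0 : m 0 = 0
  · have hm : m = single 1 (m 1) := by ext i; fin_cases i <;> simp [h0]
    have hn : ¬ (single 0 1 + single 1 1 ≤ m) := fun h => by have := h 0; simp [h0] at this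
    rw [if_neg hn, hm, ← coeff_zero_subst_single F.toPowerSeries, ← FormalGroup.zeroX,
      FormalGroup.zeroX_eq_X, PowerSeries.coeff_X]
    simp [coeff_X, single_eq_single_iff]
  · by_cases h1 : m 1 = 0
    · have hm : m = single 0 (m 0) := by ext i; fin_cases i <;> simp [h1]
      have hn : ¬ (single 0 1 + single 1 1 ≤ m) := fun h => by have := h 1; simp [h1] at this
      rw [if_neg hn, hm, ← coeff_single_subst_zero F.toPowerSeries, ← FormalGroup.Xzero,
        FormalGroup.Xzero_eq_X, PowerSeries.coeff_X]
      simp [coeff_X, single_eq_single_iff]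
    · have hle : single 0 1 + single 1 1 ≤ m := by
        intro i; fin_cases i <;> simp <;> omega
      have e0 : m ≠ single 0 1 := by rintro rfl; simp at h1
      have e1 : m ≠ single 1 1 := by rintro rfl; simp at h0
      rw [if_pos hle, coeff_X, coeff_X, if_neg e0, if_neg e1]
      have : coeff (m - (single 0 1 + single 1 1)) (mixedPart F) =
        F.toPowerSeries.coeff (m - (single 0 1 + single 1 1) + (single 0 1 + single 1 1)) := rfl
      rw [this, tsub_add_cancel_of_le hle]
      simp

theorem constantCoeff_mixedPart (F : FormalGroup R) : (mixedPart F).constantCoeff = a₁₁ F := by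
  change F.toPowerSeries.coeff (0 + (single 0 1 + single 1 1)) = _
  rw [zero_add]; rfl

theorem hasSubst_X_cons {y : PowerSeries R} (hy : y.constantCoeff = 0) :
    HasSubst ![(PowerSeries.X : PowerSeries R), y] :=
  hasSubst_of_constantCoeff_zero fun s => by
    fin_cases s
    · exact PowerSeries.constantCoeff_X
    · exact hy

theorem subst_X_eq (F : FormalGroup R) {y : PowerSeries R} (hy : y.constantCoeff = 0) :
    F.toPowerSeries.subst ![PowerSeries.X, y] = PowerSeries.X + y +
      PowerSeries.X * y * (mixedPart F).subst ![PowerSeries.X, y] := by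
  have h := hasSubst_X_cons hy
  conv_lhs => rw [eq_add_mixedPart F]
  rw [subst_add h, subst_add h, subst_mul h, subst_mul h, subst_X h, subst_X h]
  rfl

theorem dvd_subst_sub (G : MvPowerSeries (Fin 2) R) {y z : PowerSeries R}
    (hy : y.constantCoeff = 0) (hz : z.constantCoeff = 0) {n : ℕ}
    (h : (PowerSeries.X : PowerSeries R) ^ n ∣ y - z) :
    (PowerSeries.X : PowerSeries R) ^ n ∣
      G.subst ![PowerSeries.X, y] - G.subst ![PowerSeries.X, z] := by
  rw [PowerSeries.X_pow_dvd_iff]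
  intro m hm
  rw [map_sub, sub_eq_zero, PowerSeries.coeff, coeff_subst (hasSubst_X_cons hy),
    coeff_subst (hasSubst_X_cons hz)]
  refine finsum_congr fun d => ?_
  congr 1
  have : (PowerSeries.X : PowerSeries R) ^ n ∣
      PowerSeries.X ^ d 0 * y ^ d 1 - PowerSeries.X ^ d 0 * z ^ d 1 := by
    rw [← mul_sub]
    exact Dvd.dvd.mul_left (h.trans (sub_dvd_pow_sub_pow _ _ _)) _
  have := PowerSeries.X_pow_dvd_iff.1 this m hm
  rw [map_sub, sub_eq_zero] at this
  simpa [← PowerSeries.coeff_def, Finsupp.prod_fintype] using this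

theorem eq_zero_of_forall_X_pow_dvd {y : PowerSeries R}
    (h : ∀ n : ℕ, (PowerSeries.X : PowerSeries R) ^ n ∣ y) : y = 0 := by
  ext n
  exact PowerSeries.X_pow_dvd_iff.1 (h (n + 1)) n (Nat.lt_succ_self n)

/-- A contracting self-map of the maximal ideal `x R⟦x⟧` has a unique fixed point. -/
theorem existsUnique_fixedPoint (T : PowerSeries R → PowerSeries R)
    (hT0 : ∀ y, (T y).constantCoeff = 0)
    (hT : ∀ y z : PowerSeries R, y.constantCoeff = 0 → z.constantCoeff = 0 → ∀ n : ℕ,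
      (PowerSeries.X : PowerSeries R) ^ n ∣ y - z →
        (PowerSeries.X : PowerSeries R) ^ (n + 1) ∣ T y - T z) :
    ∃! y : PowerSeries R, y.constantCoeff = 0 ∧ y = T y := by
  obtain ⟨u, hu_zero, hu_succ⟩ : ∃ u : ℕ → PowerSeries R, u 0 = 0 ∧ ∀ k, u (k + 1) = T (u k) :=
    ⟨fun k => Nat.rec 0 (fun _ y => T y) k, rfl, fun _ => rfl⟩
  have hu0 (k : ℕ) : (u k).constantCoeff = 0 := by
    cases k with
    | zero => rw [hu_zero, map_zero]
    | succ k => rw [hu_succ, hT0]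
  have hu (k : ℕ) : (PowerSeries.X : PowerSeries R) ^ (k + 1) ∣ u (k + 1) - u k := by
    induction k with
    | zero => rw [zero_add, pow_one, PowerSeries.X_dvd_iff, map_sub, hu0, hu0, sub_zero]
    | succ k ih =>
      rw [hu_succ (k + 1)]
      nth_rw 2 [hu_succ k]
      exact hT _ _ (hu0 _) (hu0 _) _ ih
  have hu' (k j : ℕ) : (PowerSeries.X : PowerSeries R) ^ (k + 1) ∣ u (k + j) - u k := by
    induction j with
    | zero => simp
    | succ j ih =>
      have := (pow_dvd_pow (PowerSeries.X : PowerSeries R) (by omega : k + 1 ≤ k + j + 1)).trans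
        (hu (k + j))
      have := dvd_add this ih
      rwa [sub_add_sub_cancel] at this
  obtain ⟨y, hy⟩ : ∃ y : PowerSeries R, ∀ n, y.coeff n = (u n).coeff n :=
    ⟨PowerSeries.mk fun n => PowerSeries.coeff n (u n), fun n => PowerSeries.coeff_mk _ _⟩
  have hyu (k : ℕ) : (PowerSeries.X : PowerSeries R) ^ (k + 1) ∣ y - u k := by
    rw [PowerSeries.X_pow_dvd_iff]
    intro m hm
    obtain ⟨j, rfl⟩ := Nat.exists_eq_add_of_le (Nat.lt_succ_iff.1 hm)
    have := PowerSeries.X_pow_dvd_iff.1 (hu' m j) m (Nat.lt_succ_self m)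
    rw [map_sub, sub_eq_zero] at this ⊢
    rw [this, hy]
  have hy0 : y.constantCoeff = 0 := by
    rw [← PowerSeries.coeff_zero_eq_constantCoeff_apply, hy,
      PowerSeries.coeff_zero_eq_constantCoeff_apply, hu0]
  have hyT : y = T y := by
    rw [← sub_eq_zero]
    refine eq_zero_of_forall_X_pow_dvd fun n => ?_
    have h1 := hT y (u n) hy0 (hu0 n) _ (hyu n)
    rw [← hu_succ] at h1
    have h2 := dvd_sub (hyu (n + 1)) h1
    rw [sub_sub_sub_cancel_right] at h2
    exact (pow_dvd_pow _ (by omega)).trans h2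
  refine ⟨y, ⟨hy0, hyT⟩, ?_⟩
  rintro z ⟨hz0, hzT⟩
  rw [← sub_eq_zero]
  refine eq_zero_of_forall_X_pow_dvd fun n => ?_
  induction n with
  | zero => simp
  | succ n ih =>
    rw [hzT, hyT]
    exact hT z y hz0 hy0 n ih

theorem existsUnique_formalInverse (F : FormalGroup R) :
    ∃! y : PowerSeries R, y.constantCoeff = 0 ∧ F.toPowerSeries.subst ![PowerSeries.X, y] = 0 := by
  have key := existsUnique_fixedPoint (fun y : PowerSeries R =>
    -PowerSeries.X - PowerSeries.X * (y * (mixedPart F).subst ![PowerSeries.X, y]))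
    (fun y => by simp) (fun y z hy hz n h => by
      have h1 := dvd_subst_sub (mixedPart F) hy hz h
      generalize (mixedPart F).subst ![PowerSeries.X, y] = p at h1 ⊢
      generalize (mixedPart F).subst ![PowerSeries.X, z] = q at h1 ⊢
      have e : -PowerSeries.X - PowerSeries.X * (y * p) -
          (-PowerSeries.X - PowerSeries.X * (z * q)) =
          -(PowerSeries.X * ((y - z) * p + z * (p - q))) := by ring
      rw [e, dvd_neg, pow_succ']
      exact mul_dvd_mul_left _ (dvd_add (h.mul_right _) (h1.mul_left _)))
  refine (existsUnique_congr fun y => and_congr_right fun hy => ?_).1 key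
  rw [subst_X_eq F hy]
  generalize (mixedPart F).subst ![PowerSeries.X, y] = p
  constructor <;> intro h
  · linear_combination h
  · linear_combination h

/-- The formal inverse `ι_F`: the unique power series without constant term such that
`F(x, ι_F(x)) = 0`. -/
def formalInverse (F : FormalGroup R) : PowerSeries R :=
  (existsUnique_formalInverse F).choose

theorem constantCoeff_formalInverse (F : FormalGroup R) :
    (formalInverse F).constantCoeff = 0 :=
  (existsUnique_formalInverse F).choose_spec.1.1

theorem subst_formalInverse (F : FormalGroup R) :
    F.toPowerSeries.subst ![PowerSeries.X, formalInverse F] = 0 :=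
  (existsUnique_formalInverse F).choose_spec.1.2

/-- `divX g = (g - g(0)) / x`. -/
def divX (g : PowerSeries R) : PowerSeries R :=
  PowerSeries.mk fun n => PowerSeries.coeff (n + 1) g

theorem X_mul_divX {g : PowerSeries R} (hg : g.constantCoeff = 0) :
    PowerSeries.X * divX g = g := by
  have := PowerSeries.sub_const_eq_X_mul_shift g
  rw [hg, map_zero, sub_zero] at this
  exact this.symm

/-- `μ_F(x) = ι_F(x) / (-x)`. -/
def mu (F : FormalGroup R) : PowerSeries R := -divX (formalInverse F)

theorem X_mul_mu (F : FormalGroup R) : -PowerSeries.X * mu F = formalInverse F := by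
  rw [mu, neg_mul_neg, X_mul_divX (constantCoeff_formalInverse F)]

theorem mu_eq (F : FormalGroup R) :
    mu F = 1 + formalInverse F * (mixedPart F).subst ![PowerSeries.X, formalInverse F] := by
  have h := subst_formalInverse F
  rw [subst_X_eq F (constantCoeff_formalInverse F)] at h
  have h2 : (PowerSeries.X : PowerSeries R) * mu F = PowerSeries.X *
      (1 + formalInverse F * (mixedPart F).subst ![PowerSeries.X, formalInverse F]) := by
    linear_combination -h - X_mul_mu F
  ext n
  simpa using congrArg (PowerSeries.coeff (n + 1)) h2

theorem constantCoeff_mu (F : FormalGroup R) : (mu F).constantCoeff = 1 := by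
  rw [mu_eq, map_add, map_one, map_mul, constantCoeff_formalInverse, zero_mul, add_zero]

/-- `κ^F(x) = 1/x + 1/ι_F(x)`. Since `ι_F(x) = -x μ_F(x)` and `μ_F` is invertible, this is
`(1 - μ_F(x)⁻¹) / x`, a power series. -/
def kappa (F : FormalGroup R) : PowerSeries R := divX (1 - PowerSeries.invOfUnit (mu F) 1)

theorem X_mul_formalInverse_mul_kappa (F : FormalGroup R) :
    PowerSeries.X * formalInverse F * kappa F = formalInverse F + PowerSeries.X := by
  have h1 : PowerSeries.X * kappa F = 1 - PowerSeries.invOfUnit (mu F) 1 := by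
    refine X_mul_divX ?_
    rw [map_sub, PowerSeries.constantCoeff_invOfUnit]; simp
  have h2 : mu F * PowerSeries.invOfUnit (mu F) 1 = 1 :=
    PowerSeries.mul_invOfUnit _ _ (by rw [constantCoeff_mu]; rfl)
  rw [mul_right_comm, h1, ← X_mul_mu]
  linear_combination PowerSeries.X * h2

/-- `h(x) = (ι_F(x) + x) / x`. -/
def hSeries (F : FormalGroup R) : PowerSeries R := divX (formalInverse F + PowerSeries.X)

theorem hSeries_eq (F : FormalGroup R) : hSeries F = 1 - mu F := by
  ext n
  simp [hSeries, mu, divX, PowerSeries.coeff_X, PowerSeries.coeff_one, add_comm]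

theorem constantCoeff_hSeries (F : FormalGroup R) : (hSeries F).constantCoeff = 0 := by
  rw [hSeries_eq, map_sub, constantCoeff_mu, map_one, sub_self]

theorem coeff_one_hSeries (F : FormalGroup R) : (hSeries F).coeff 1 = a₁₁ F := by
  have e : hSeries F = PowerSeries.X *
      (mu F * (mixedPart F).subst ![PowerSeries.X, formalInverse F]) := by
    rw [hSeries_eq]
    linear_combination -mu_eq F +
      (mixedPart F).subst ![PowerSeries.X, formalInverse F] * X_mul_mu F
  rw [e, ← zero_add 1, PowerSeries.coeff_succ_X_mul, PowerSeries.coeff_zero_eq_constantCoeff_apply,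
    map_mul, constantCoeff_mu, one_mul]
  have := hasSubst_X_cons (constantCoeff_formalInverse F)
  rw [← constantCoeff_mixedPart]
  change MvPowerSeries.constantCoeff _ = _
  rw [constantCoeff_subst this, finsum_eq_single _ 0]
  · simp
  · intro d hd
    obtain ⟨i, hi⟩ := Finsupp.ne_iff.1 hd
    have hi' : ∀ s, (![(PowerSeries.X : PowerSeries R), formalInverse F] s).constantCoeff = 0 := by
      intro s
      fin_cases s
      · exact PowerSeries.constantCoeff_X
      · exact constantCoeff_formalInverse F
    rw [map_finsuppProd, Finsupp.prod_fintype _ _ (by simp),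
      Finset.prod_eq_zero (Finset.mem_univ i), smul_zero]
    rw [map_pow]
    exact (congrArg (· ^ d i) (hi' i)).trans (zero_pow hi)

theorem isUnit_coeff_one_hSeries (F : FormalGroup R) (ha : IsUnit (a₁₁ F)) :
    IsUnit ((hSeries F).coeff 1) := by
  rwa [coeff_one_hSeries]

variable (F : FormalGroup R) (ha : IsUnit (a₁₁ F))

/-- The composition inverse `f` of `h`, which exists when `a₁₁` is invertible. -/
def fSeries : PowerSeries R := (hSeries F).substInvOfIsUnit (isUnit_coeff_one_hSeries F ha)

theorem hSeries_subst_fSeries : (hSeries F).subst (fSeries F ha) = PowerSeries.X :=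
  PowerSeries.subst_substInvOfIsUnit_right _ (constantCoeff_hSeries F) _

theorem fSeries_subst_hSeries : (fSeries F ha).subst (hSeries F) = PowerSeries.X :=
  PowerSeries.subst_substInvOfIsUnit_left _ (constantCoeff_hSeries F) _

theorem constantCoeff_fSeries : (fSeries F ha).constantCoeff = 0 :=
  PowerSeries.constantCoeff_substInvOfIsUnit _ _

/-- The series `h(F(f(x), f(y)))`. -/
def normalizationSeries : MvPowerSeries (Fin 2) R :=
  (hSeries F).subst (F.toPowerSeries.subst
    ![(fSeries F ha).subst (X 0 : MvPowerSeries (Fin 2) R),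
      (fSeries F ha).subst (X 1 : MvPowerSeries (Fin 2) R)])

theorem constantCoeff_fSeries_subst {σ : Type*} {p : MvPowerSeries σ R}
    (hp : p.constantCoeff = 0) :
    MvPowerSeries.constantCoeff ((fSeries F ha).subst p : MvPowerSeries σ R) = 0 :=
  PowerSeries.constantCoeff_subst_eq_zero hp _ (constantCoeff_fSeries F ha)

theorem constantCoeff_hSeries_subst {σ : Type*} {p : MvPowerSeries σ R}
    (hp : p.constantCoeff = 0) :
    MvPowerSeries.constantCoeff ((hSeries F).subst p : MvPowerSeries σ R) = 0 :=
  PowerSeries.constantCoeff_subst_eq_zero hp _ (constantCoeff_hSeries F)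

theorem hasSubst_pair {σ : Type*} {p q : MvPowerSeries σ R}
    (hp : p.constantCoeff = 0) (hq : q.constantCoeff = 0) : HasSubst ![p, q] :=
  hasSubst_of_constantCoeff_zero fun s => by
    fin_cases s
    · exact hp
    · exact hq

theorem constantCoeff_subst_pair (G : FormalGroup R) {σ : Type*} {p q : MvPowerSeries σ R}
    (hp : p.constantCoeff = 0) (hq : q.constantCoeff = 0) :
    MvPowerSeries.constantCoeff (G.toPowerSeries.subst ![p, q] : MvPowerSeries σ R) = 0 :=
  constantCoeff_subst_eq_zero (hasSubst_pair hp hq)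
    (fun s => by
      fin_cases s
      · exact hp
      · exact hq) G.zero_constantCoeff

theorem normalizationSeries_subst {σ : Type*} {p q : MvPowerSeries σ R}
    (hp : p.constantCoeff = 0) (hq : q.constantCoeff = 0) :
    (normalizationSeries F ha).subst ![p, q] =
      (hSeries F).subst (F.toPowerSeries.subst ![(fSeries F ha).subst p, (fSeries F ha).subst q]) := by
  have h0 : (X 0 : MvPowerSeries (Fin 2) R).constantCoeff = 0 := constantCoeff_X 0
  have h1 : (X 1 : MvPowerSeries (Fin 2) R).constantCoeff = 0 := constantCoeff_X 1
  have f0 := constantCoeff_fSeries_subst F ha h0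
  have f1 := constantCoeff_fSeries_subst F ha h1
  have hF := constantCoeff_subst_pair F f0 f1
  have hpq := hasSubst_pair hp hq
  have e := subst_comp_subst_apply (PowerSeries.HasSubst.of_constantCoeff_zero hF).const hpq
    (hSeries F)
  refine e.trans ?_
  change _ = subst (fun _ => _) (hSeries F)
  congr 1
  funext _
  rw [subst_comp_subst_apply (hasSubst_pair f0 f1) hpq]
  congr 1
  funext s
  fin_cases s
  · change subst ![p, q] ((fSeries F ha).subst (X 0 : MvPowerSeries (Fin 2) R)) = _
    rw [PowerSeries.subst, subst_comp_subst_apply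
      (PowerSeries.HasSubst.of_constantCoeff_zero h0).const hpq, subst_X hpq]
    rfl
  · change subst ![p, q] ((fSeries F ha).subst (X 1 : MvPowerSeries (Fin 2) R)) = _
    rw [PowerSeries.subst, subst_comp_subst_apply
      (PowerSeries.HasSubst.of_constantCoeff_zero h1).const hpq, subst_X hpq]
    rfl

theorem fSeries_subst_hSeries_subst {σ : Type*} {p : MvPowerSeries σ R}
    (hp : p.constantCoeff = 0) :
    (fSeries F ha).subst ((hSeries F).subst p : MvPowerSeries σ R) = p := by
  have hp' := PowerSeries.HasSubst.of_constantCoeff_zero hp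
  have := PowerSeries.subst_comp_subst_apply
    (PowerSeries.HasSubst.of_constantCoeff_zero' (constantCoeff_hSeries F)) hp' (fSeries F ha)
  rw [← this, fSeries_subst_hSeries, PowerSeries.subst_X hp']

theorem hSeries_subst_fSeries_subst {σ : Type*} {p : MvPowerSeries σ R}
    (hp : p.constantCoeff = 0) :
    (hSeries F).subst ((fSeries F ha).subst p : MvPowerSeries σ R) = p := by
  have hp' := PowerSeries.HasSubst.of_constantCoeff_zero hp
  have := PowerSeries.subst_comp_subst_apply
    (PowerSeries.HasSubst.of_constantCoeff_zero' (constantCoeff_fSeries F ha)) hp' (hSeries F)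
  rw [← this, hSeries_subst_fSeries, PowerSeries.subst_X hp']

/-- The normalization `F̃` of `F`: the formal group law `F̃(x, y) = h(F(f(x), f(y)))`. -/
def normalization : FormalGroup R where
  toPowerSeries := normalizationSeries F ha
  zero_constantCoeff := by
    have h0 : (X 0 : MvPowerSeries (Fin 2) R).constantCoeff = 0 := constantCoeff_X 0
    have h1 : (X 1 : MvPowerSeries (Fin 2) R).constantCoeff = 0 := constantCoeff_X 1
    exact constantCoeff_hSeries_subst F (constantCoeff_subst_pair F
      (constantCoeff_fSeries_subst F ha h0) (constantCoeff_fSeries_subst F ha h1))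
  lin_coeff_X := by
    have hX : (PowerSeries.X : PowerSeries R).constantCoeff = 0 := PowerSeries.constantCoeff_X
    have hf := constantCoeff_fSeries_subst F ha hX
    rw [← coeff_single_subst_zero, normalizationSeries_subst F ha hX (map_zero _),
      PowerSeries.subst_zero_of_constantCoeff_zero (constantCoeff_fSeries F ha),
      FormalGroup.add_zero F (PowerSeries.HasSubst.of_constantCoeff_zero hf),
      hSeries_subst_fSeries_subst F ha hX, PowerSeries.coeff_one_X]
  lin_coeff_Y := by
    have hX : (PowerSeries.X : PowerSeries R).constantCoeff = 0 := PowerSeries.constantCoeff_X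
    have hf := constantCoeff_fSeries_subst F ha hX
    rw [← coeff_zero_subst_single, normalizationSeries_subst F ha (map_zero _) hX,
      PowerSeries.subst_zero_of_constantCoeff_zero (constantCoeff_fSeries F ha),
      FormalGroup.zero_add F (PowerSeries.HasSubst.of_constantCoeff_zero hf),
      hSeries_subst_fSeries_subst F ha hX, PowerSeries.coeff_one_X]
  assoc := by
    have h (i : Fin 3) : (X i : MvPowerSeries (Fin 3) R).constantCoeff = 0 := constantCoeff_X i
    have hf (i : Fin 3) := constantCoeff_fSeries_subst F ha (h i)
    have hs (i : Fin 3) := PowerSeries.HasSubst.of_constantCoeff_zero (hf i)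
    have hF (i j : Fin 3) := constantCoeff_subst_pair F (hf i) (hf j)
    have hh (i j : Fin 3) := constantCoeff_hSeries_subst F (hF i j)
    rw [normalizationSeries_subst F ha (h 0) (h 1), normalizationSeries_subst F ha (h 1) (h 2),
      normalizationSeries_subst F ha (hh 0 1) (h 2), normalizationSeries_subst F ha (h 0) (hh 1 2),
      fSeries_subst_hSeries_subst F ha (hF 0 1), fSeries_subst_hSeries_subst F ha (hF 1 2),
      F.assoc' (hs 0) (hs 1) (hs 2)]

instance [F.IsComm] : (normalization F ha).IsComm where
  comm := by
    have h (i : Fin 2) : (X i : MvPowerSeries (Fin 2) R).constantCoeff = 0 := constantCoeff_X i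
    have hs (i : Fin 2) := PowerSeries.HasSubst.of_constantCoeff_zero
      (constantCoeff_fSeries_subst F ha (h i))
    change normalizationSeries F ha = (normalizationSeries F ha).subst ![X 1, X 0]
    rw [normalizationSeries_subst F ha (h 1) (h 0), normalizationSeries, F.comm' (hs 0) (hs 1)]

end FormalGroupLaws

section FormalGroupAlgebra

/-- `R⟦x_Λ⟧`: the completion of the polynomial ring `R[x_Λ]` in variables `x_λ`, `λ ∈ Λ`, at the
kernel of the augmentation `x_λ ↦ 0`, that is, at the ideal generated by the variables. -/
abbrev CPoly (R : Type*) [CommRing R] (Λ : Type*) : Type _ :=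
  AdicCompletion (MvPolynomial.idealOfVars Λ R) (MvPolynomial Λ R)

theorem idealOfVars_pow_le_comap_rename {Λ Λ' : Type*} (v : Λ → Λ') (n : ℕ) :
    MvPolynomial.idealOfVars Λ R ^ n ≤
      (MvPolynomial.idealOfVars Λ' R ^ n).comap (MvPolynomial.rename (R := R) v) := by
  rw [← Ideal.map_le_iff_le_comap, Ideal.map_pow]
  refine Ideal.pow_right_mono ?_ n
  rw [Ideal.map_le_iff_le_comap, Ideal.span_le]
  rintro _ ⟨l, rfl⟩
  change MvPolynomial.rename v (MvPolynomial.X l : MvPolynomial Λ R) ∈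
    MvPolynomial.idealOfVars Λ' R
  rw [MvPolynomial.rename_X]
  exact Ideal.subset_span ⟨_, rfl⟩

/-- The reduction modulo degree `n` of the map `R⟦x_Λ⟧ → R⟦x_Λ'⟧`, `x_λ ↦ x_{v(λ)}`. -/
def CPoly.mapAux {Λ Λ' : Type*} (v : Λ → Λ') (n : ℕ) :
    CPoly R Λ →ₐ[R] MvPolynomial Λ' R ⧸ MvPolynomial.idealOfVars Λ' R ^ n :=
  (Ideal.quotientMapₐ (MvPolynomial.idealOfVars Λ' R ^ n) (MvPolynomial.rename (R := R) v)
    (idealOfVars_pow_le_comap_rename v n)).comp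
      ((AdicCompletion.evalₐ (MvPolynomial.idealOfVars Λ R) n).restrictScalars R)

theorem CPoly.mapAux_mk {Λ Λ' : Type*} (v : Λ → Λ') (n : ℕ)
    (s : AdicCompletion.AdicCauchySequence (MvPolynomial.idealOfVars Λ R) (MvPolynomial Λ R)) :
    CPoly.mapAux v n (AdicCompletion.mk _ _ s) =
      Ideal.Quotient.mk _ (MvPolynomial.rename (R := R) v (s n)) := by
  simp [CPoly.mapAux]

theorem CPoly.mapAux_compat {Λ Λ' : Type*} (v : Λ → Λ') {m n : ℕ} (hle : m ≤ n) :
    (Ideal.Quotient.factorₐ R (Ideal.pow_le_pow_right hle)).comp (CPoly.mapAux (R := R) v n) =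
      CPoly.mapAux v m :=
  AlgHom.ext fun x => by
    obtain ⟨s, rfl⟩ := AdicCompletion.mk_surjective _ _ x
    rw [AlgHom.comp_apply, CPoly.mapAux_mk, CPoly.mapAux_mk]
    have h := AdicCompletion.Ideal.mk_eq_mk _ hle s
    rw [Ideal.Quotient.mk_eq_mk_iff_sub_mem] at h
    change Ideal.Quotient.mk _ _ = _
    rw [Ideal.Quotient.mk_eq_mk_iff_sub_mem, ← map_sub]
    exact idealOfVars_pow_le_comap_rename v m h

/-- The continuous map `R⟦x_Λ⟧ → R⟦x_Λ'⟧`, `x_λ ↦ x_{v(λ)}`, induced by a map of index sets. -/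
def CPoly.map {Λ Λ' : Type*} (v : Λ → Λ') : CPoly R Λ →ₐ[R] CPoly R Λ' :=
  AdicCompletion.liftAlgHom (MvPolynomial.idealOfVars Λ' R) (CPoly.mapAux v)
    (CPoly.mapAux_compat v)

theorem CPoly.evalₐ_map_mk {Λ Λ' : Type*} (v : Λ → Λ') (n : ℕ)
    (s : AdicCompletion.AdicCauchySequence (MvPolynomial.idealOfVars Λ R) (MvPolynomial Λ R)) :
    AdicCompletion.evalₐ _ n (CPoly.map v (AdicCompletion.mk _ _ s)) =
      Ideal.Quotient.mk _ (MvPolynomial.rename (R := R) v (s n)) := by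
  rw [CPoly.map, AdicCompletion.evalₐ_liftAlgHom _ _ (CPoly.mapAux_compat v), CPoly.mapAux_mk]

theorem CPoly.map_id {Λ : Type*} (z : CPoly R Λ) : CPoly.map id z = z := by
  obtain ⟨s, rfl⟩ := AdicCompletion.mk_surjective _ _ z
  refine AdicCompletion.ext_evalₐ fun n => ?_
  rw [CPoly.evalₐ_map_mk, AdicCompletion.evalₐ_mk, MvPolynomial.rename_id_apply]

theorem CPoly.map_map {Λ Λ' Λ'' : Type*} (v : Λ → Λ') (w : Λ' → Λ'') (z : CPoly R Λ) :
    CPoly.map w (CPoly.map v z) = CPoly.map (w ∘ v) z := by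
  refine AdicCompletion.ext_evalₐ fun n => ?_
  obtain ⟨s, rfl⟩ := AdicCompletion.mk_surjective _ _ z
  obtain ⟨t, ht⟩ := AdicCompletion.mk_surjective _ _ (CPoly.map v (AdicCompletion.mk _ _ s))
  have h := CPoly.evalₐ_map_mk v n s
  rw [← ht, AdicCompletion.evalₐ_mk, Ideal.Quotient.mk_eq_mk_iff_sub_mem] at h
  rw [← ht, CPoly.evalₐ_map_mk, CPoly.evalₐ_map_mk, Ideal.Quotient.mk_eq_mk_iff_sub_mem,
    ← MvPolynomial.rename_rename, ← map_sub]
  exact idealOfVars_pow_le_comap_rename w n h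

/-- Substitution of the variables `x_{v(i)}` into a power series in finitely many variables. -/
def CPoly.substVars {Λ σ : Type*} [Finite σ] (v : σ → Λ) (G : MvPowerSeries σ R) : CPoly R Λ :=
  CPoly.map v (MvPowerSeries.toAdicCompletion σ R G)

/-- The variable `x_λ` in `R⟦x_Λ⟧`. -/
def CPoly.var {Λ : Type*} (l : Λ) : CPoly R Λ :=
  AdicCompletion.of (MvPolynomial.idealOfVars Λ R) (MvPolynomial Λ R) (MvPolynomial.X l)

theorem CPoly.map_var {Λ Λ' : Type*} (v : Λ → Λ') (l : Λ) :
    CPoly.map v (CPoly.var l : CPoly R Λ) = CPoly.var (v l) := by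
  refine AdicCompletion.ext_evalₐ fun n => ?_
  rw [CPoly.map, AdicCompletion.evalₐ_liftAlgHom _ _ (CPoly.mapAux_compat v), CPoly.mapAux, AlgHom.comp_apply]
  simp [CPoly.var]

theorem CPoly.map_substVars {Λ Λ' σ : Type*} [Finite σ] (w : Λ → Λ') (v : σ → Λ)
    (G : MvPowerSeries σ R) :
    CPoly.map w (CPoly.substVars v G) = CPoly.substVars (w ∘ v) G :=
  CPoly.map_map v w _

/-- The closure of an ideal of `R⟦x_Λ⟧` for the topology of the completion, in which the kernels of
the projections `R⟦x_Λ⟧ → R[x_Λ] / (ker ε)ⁿ` form a basis of neighbourhoods of `0`. -/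
def CPoly.closure {Λ : Type*} (J : Ideal (CPoly R Λ)) : Ideal (CPoly R Λ) :=
  ⨅ n : ℕ, J ⊔ RingHom.ker (AdicCompletion.evalₐ (MvPolynomial.idealOfVars Λ R) n)

theorem CPoly.closure_le_comap_map {Λ Λ' : Type*} (v : Λ → Λ') (J : Ideal (CPoly R Λ))
    (J' : Ideal (CPoly R Λ')) (h : J ≤ J'.comap (CPoly.map v)) :
    CPoly.closure J ≤ (CPoly.closure J').comap (CPoly.map v) := by
  intro z hz
  rw [Ideal.mem_comap, CPoly.closure, Ideal.mem_iInf]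
  intro n
  obtain ⟨a, ha, b, hb, rfl⟩ := Submodule.mem_sup.1 (Ideal.mem_iInf.1 hz n)
  rw [map_add]
  refine Ideal.add_mem _ (Ideal.mem_sup_left (h ha)) (Ideal.mem_sup_right ?_)
  obtain ⟨s, rfl⟩ := AdicCompletion.mk_surjective _ _ b
  rw [RingHom.mem_ker, AdicCompletion.evalₐ_mk, Ideal.Quotient.eq_zero_iff_mem] at hb
  rw [RingHom.mem_ker, CPoly.evalₐ_map_mk, Ideal.Quotient.eq_zero_iff_mem]
  exact idealOfVars_pow_le_comap_rename v n hb

variable (F : FormalGroup R) (Λ : Type*) [AddCommGroup Λ]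

/-- The ideal `𝒥_F` of `R⟦x_Λ⟧`: the closure of the ideal generated by `x_0` and the elements
`x_{λ₁ + λ₂} - F(x_{λ₁}, x_{λ₂})`. -/
def relIdeal : Ideal (CPoly R Λ) :=
  CPoly.closure (Ideal.span ({CPoly.var (0 : Λ)} ∪ Set.range fun p : Λ × Λ =>
    CPoly.var (p.1 + p.2) - CPoly.substVars ![p.1, p.2] F.toPowerSeries))

/-- The formal group algebra `R⟦Λ⟧_F = R⟦x_Λ⟧ / 𝒥_F`. -/
def FGA : Type _ := CPoly R Λ ⧸ relIdeal F Λ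

instance : CommRing (FGA F Λ) := inferInstanceAs (CommRing (CPoly R Λ ⧸ relIdeal F Λ))

instance : Algebra R (FGA F Λ) := inferInstanceAs (Algebra R (CPoly R Λ ⧸ relIdeal F Λ))

variable {Λ}

/-- The quotient map `R⟦x_Λ⟧ → R⟦Λ⟧_F`. -/
def FGA.mk : CPoly R Λ →ₐ[R] FGA F Λ := Ideal.Quotient.mkₐ R (relIdeal F Λ)

/-- The element `x_λ` of `R⟦Λ⟧_F`. -/
def FGA.x (l : Λ) : FGA F Λ := FGA.mk F (CPoly.var l)

/-- The element `g(x_λ)` of `R⟦Λ⟧_F`, for a power series `g` in one variable. -/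
def FGA.eval (g : PowerSeries R) (l : Λ) : FGA F Λ :=
  FGA.mk F (CPoly.substVars (fun _ : Unit => l) g)

/-- The filtration of `R⟦Λ⟧_F` by the images of the ideals `ker (R⟦x_Λ⟧ → R[x_Λ] / (ker ε)ⁿ)`; it
is a basis of neighbourhoods of `0` for the quotient topology. -/
def FGA.fil (n : ℕ) : Ideal (FGA F Λ) :=
  (RingHom.ker (AdicCompletion.evalₐ (MvPolynomial.idealOfVars Λ R) n)).map (FGA.mk F)

theorem relIdeal_le_comap {Λ' : Type*} [AddCommGroup Λ'] (g : Λ →+ Λ') :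
    relIdeal F Λ ≤ (relIdeal F Λ').comap (CPoly.map g) := by
  refine CPoly.closure_le_comap_map _ _ _ ?_
  rw [Ideal.span_le]
  rintro _ (rfl | ⟨p, rfl⟩)
  · rw [SetLike.mem_coe, Ideal.mem_comap, CPoly.map_var, map_zero]
    exact Ideal.subset_span (Or.inl rfl)
  · rw [SetLike.mem_coe, Ideal.mem_comap]
    refine Ideal.subset_span (Or.inr ⟨(g p.1, g p.2), ?_⟩)
    have e : (![g p.1, g p.2] : Fin 2 → Λ') = g ∘ ![p.1, p.2] := by
      ext i; fin_cases i <;> rfl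
    simp only [map_sub, CPoly.map_var, CPoly.map_substVars, map_add, e]

/-- The map `R⟦Λ⟧_F → R⟦Λ'⟧_F`, `x_λ ↦ x_{g(λ)}`, induced by a group homomorphism `g`. -/
def FGA.map {Λ' : Type*} [AddCommGroup Λ'] (g : Λ →+ Λ') : FGA F Λ →ₐ[R] FGA F Λ' :=
  Ideal.quotientMapₐ (relIdeal F Λ') (CPoly.map g) (relIdeal_le_comap F g)

theorem FGA.map_mk {Λ' : Type*} [AddCommGroup Λ'] (g : Λ →+ Λ') (z : CPoly R Λ) :
    FGA.map F g (FGA.mk F z) = FGA.mk F (CPoly.map g z) := rfl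

theorem FGA.mk_surjective : Function.Surjective (FGA.mk F (Λ := Λ)) := Ideal.Quotient.mk_surjective

theorem FGA.map_x {Λ' : Type*} [AddCommGroup Λ'] (g : Λ →+ Λ') (l : Λ) :
    FGA.map F g (FGA.x F l) = FGA.x F (g l) := by
  rw [FGA.x, FGA.map_mk, CPoly.map_var]; rfl

theorem FGA.map_eval {Λ' : Type*} [AddCommGroup Λ'] (g : Λ →+ Λ') (k : PowerSeries R) (l : Λ) :
    FGA.map F g (FGA.eval F k l) = FGA.eval F k (g l) := by
  rw [FGA.eval, FGA.map_mk, CPoly.map_substVars]; rfl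

theorem FGA.map_id (u : FGA F Λ) : FGA.map F (AddMonoidHom.id Λ) u = u := by
  obtain ⟨z, rfl⟩ := FGA.mk_surjective F u
  rw [FGA.map_mk]
  exact congrArg _ (CPoly.map_id z)

theorem FGA.map_map {Λ' Λ'' : Type*} [AddCommGroup Λ'] [AddCommGroup Λ''] (g : Λ →+ Λ')
    (g' : Λ' →+ Λ'') (u : FGA F Λ) :
    FGA.map F g' (FGA.map F g u) = FGA.map F (g'.comp g) u := by
  obtain ⟨z, rfl⟩ := FGA.mk_surjective F u
  rw [FGA.map_mk, FGA.map_mk, FGA.map_mk, CPoly.map_map]; rfl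

end FormalGroupAlgebra

section Localization

variable {W A ι : Type*} [Group W] [CommRing A] [MulSemiringAction W A]

/-- The localization `A[1/s_i | i ∈ ι]`. -/
def Loc (s : ι → A) : Type _ := Localization (Submonoid.closure (Set.range s))

variable (s : ι → A)

instance : CommRing (Loc s) :=
  inferInstanceAs (CommRing (Localization (Submonoid.closure (Set.range s))))

instance {R : Type*} [CommRing R] [Algebra R A] : Algebra R (Loc s) :=
  inferInstanceAs (Algebra R (Localization (Submonoid.closure (Set.range s))))

instance {R : Type*} [CommRing R] [Algebra R A] : IsScalarTower R A (Loc s) :=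
  inferInstanceAs (IsScalarTower R A (Localization (Submonoid.closure (Set.range s))))

instance : IsLocalization (Submonoid.closure (Set.range s)) (Loc s) :=
  inferInstanceAs (IsLocalization _ (Localization (Submonoid.closure (Set.range s))))

/-- The element `1/s_i`. -/
def Loc.inv (i : ι) : Loc s :=
  IsLocalization.mk' (M := Submonoid.closure (Set.range s)) (Loc s) 1
    ⟨s i, Submonoid.subset_closure ⟨i, rfl⟩⟩

theorem Loc.algebraMap_mul_inv (i : ι) : algebraMap A (Loc s) (s i) * Loc.inv s i = 1 :=
  (IsLocalization.mul_mk'_eq_mk'_of_mul _ _ _).trans (by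
    rw [mul_one]
    exact IsLocalization.mk'_self' (M := Submonoid.closure (Set.range s)) (Loc s))

theorem Loc.closure_le_comap (hs : ∀ (w : W) (i : ι), ∃ j, w • s i = s j) (w : W) :
    Submonoid.closure (Set.range s) ≤
      (Submonoid.closure (Set.range s)).comap (MulSemiringAction.toRingHom W A w) := by
  rw [Submonoid.closure_le]
  rintro _ ⟨i, rfl⟩
  obtain ⟨j, hj⟩ := hs w i
  have h : w • s i ∈ Submonoid.closure (Set.range s) :=
    hj ▸ Submonoid.subset_closure ⟨j, rfl⟩
  exact h

/-- The extension of a group action on `A` to `A[1/s_i | i ∈ ι]`, when the group permutes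
the `s_i`. -/
@[reducible]
def Loc.action (hs : ∀ (w : W) (i : ι), ∃ j, w • s i = s j) : MulSemiringAction W (Loc s) where
  smul w := IsLocalization.map (Loc s) (MulSemiringAction.toRingHom W A w)
    (Loc.closure_le_comap s hs w)
  one_smul q := by
    change IsLocalization.map (Loc s) (MulSemiringAction.toRingHom W A 1) _ q = q
    have h : MulSemiringAction.toRingHom W A 1 = RingHom.id A := by ext; simp
    simp only [h]
    exact IsLocalization.map_id (M := Submonoid.closure (Set.range s)) q
  mul_smul v w q := by
    change IsLocalization.map (Loc s) (MulSemiringAction.toRingHom W A (v * w)) _ q =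
      IsLocalization.map (Loc s) (MulSemiringAction.toRingHom W A v) _
        (IsLocalization.map (Loc s) (MulSemiringAction.toRingHom W A w) _ q)
    rw [IsLocalization.map_map (Loc.closure_le_comap s hs w)]
    congr 2
    ext; simp [mul_smul]
  smul_zero w := map_zero (IsLocalization.map (Loc s) (MulSemiringAction.toRingHom W A w)
    (Loc.closure_le_comap s hs w))
  smul_add w := map_add (IsLocalization.map (Loc s) (MulSemiringAction.toRingHom W A w)
    (Loc.closure_le_comap s hs w))
  smul_one w := map_one (IsLocalization.map (Loc s) (MulSemiringAction.toRingHom W A w)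
    (Loc.closure_le_comap s hs w))
  smul_mul w := map_mul (IsLocalization.map (Loc s) (MulSemiringAction.toRingHom W A w)
    (Loc.closure_le_comap s hs w))

theorem Loc.action_algebraMap (hs : ∀ (w : W) (i : ι), ∃ j, w • s i = s j) (w : W) (u : A) :
    letI := Loc.action s hs
    w • algebraMap A (Loc s) u = algebraMap A (Loc s) (w • u) :=
  IsLocalization.map_eq (Loc.closure_le_comap s hs w) u

theorem Loc.action_smulCommClass (hs : ∀ (w : W) (i : ι), ∃ j, w • s i = s j)
    (R : Type*) [CommRing R] [Algebra R A] [SMulCommClass W R A] :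
    letI := Loc.action s hs
    SMulCommClass W R (Loc s) := by
  letI := Loc.action s hs
  refine ⟨fun w r q => ?_⟩
  have h : w • algebraMap R (Loc s) r = algebraMap R (Loc s) r := by
    rw [IsScalarTower.algebraMap_apply R A (Loc s), Loc.action_algebraMap, smul_algebraMap]
  rw [Algebra.smul_def, Algebra.smul_def, smul_mul', h]

end Localization

section WeylGroup

variable {ι Λ Λ' : Type*} [AddCommGroup Λ] [AddCommGroup Λ'] (P : RootDatum ι Λ Λ')
  (F : FormalGroup R)

/-- The action of the Weyl group on `R⟦Λ⟧_F`, `w(x_λ) = x_{w(λ)}`. -/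
instance : MulSemiringAction P.weylGroup (FGA F Λ) where
  smul w u := FGA.map F (DistribSMul.toAddMonoidHom Λ w) u
  one_smul u := by
    change FGA.map F (DistribSMul.toAddMonoidHom Λ (1 : P.weylGroup)) u = u
    have h : DistribSMul.toAddMonoidHom Λ (1 : P.weylGroup) = AddMonoidHom.id Λ := by
      ext; simp
    rw [h, FGA.map_id]
  mul_smul v w u := by
    change FGA.map F (DistribSMul.toAddMonoidHom Λ (v * w)) u =
      FGA.map F (DistribSMul.toAddMonoidHom Λ v) (FGA.map F (DistribSMul.toAddMonoidHom Λ w) u)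
    rw [FGA.map_map]
    congr 1
  smul_zero w := map_zero (FGA.map F (DistribSMul.toAddMonoidHom Λ w))
  smul_add w := map_add (FGA.map F (DistribSMul.toAddMonoidHom Λ w))
  smul_one w := map_one (FGA.map F (DistribSMul.toAddMonoidHom Λ w))
  smul_mul w := map_mul (FGA.map F (DistribSMul.toAddMonoidHom Λ w))

instance : SMulCommClass P.weylGroup R (FGA F Λ) where
  smul_comm w r u := map_smul (FGA.map F (DistribSMul.toAddMonoidHom Λ w)) r u

theorem FGA.smul_x (w : P.weylGroup) (l : Λ) : w • FGA.x F l = FGA.x F (w • l) :=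
  FGA.map_x F _ l

theorem FGA.smul_eval (w : P.weylGroup) (g : PowerSeries R) (l : Λ) :
    w • FGA.eval F g l = FGA.eval F g (w • l) :=
  FGA.map_eval F _ g l

end WeylGroup

/-- In the twisted group algebra `B ♯ W`, with elements `∑ q δ_w` and product
`q δ_w ⬝ q' δ_{w'} = q w(q') δ_{ww'}`, the element `y (1 - δ_s)`. -/
def demazureElement {B W : Type*} [CommRing B] [Group W] [MulSemiringAction W B] (y : B) (s : W) :
    SkewMonoidAlgebra B W :=
  SkewMonoidAlgebra.single 1 y * (1 - SkewMonoidAlgebra.single s 1)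

section Demazure

variable {ι Λ Λ' : Type*} [AddCommGroup Λ] [AddCommGroup Λ']
  (F : FormalGroup R) (P : RootDatum ι Λ Λ')

/-- The element `x_α` of `R⟦Λ⟧_F`, where `α` is the root with index `i`. -/
abbrev xRoot (i : ι) : FGA F Λ := FGA.x F (P.root i)

theorem smul_xRoot (w : P.weylGroup) (i : ι) : ∃ j, w • xRoot F P i = xRoot F P j :=
  ⟨P.weylGroupToPerm w i, by rw [xRoot, FGA.smul_x, RootPairing.weylGroup_apply_root]⟩

/-- `Q^F = R⟦Λ⟧_F[1/x_α | α ∈ Σ]`. -/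
abbrev Q : Type _ := Loc (xRoot F P)

instance : MulSemiringAction P.weylGroup (Q F P) := Loc.action _ (smul_xRoot F P)

instance : SMulCommClass P.weylGroup R (Q F P) := Loc.action_smulCommClass _ (smul_xRoot F P) R

/-- The twisted formal group algebra `Q_W^F = Q^F ♯_R R[W]`. The element `q δ_w` is
`SkewMonoidAlgebra.single w q`. -/
abbrev QW : Type _ := SkewMonoidAlgebra (Q F P) P.weylGroup

/-- The Demazure element `X_α = (1/x_α)(1 - δ_{s_α})`. -/
def X (i : ι) : QW F P :=
  demazureElement (Loc.inv (xRoot F P) i) (RootPairing.weylGroup.ofIdx P i)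

/-- The formal affine Demazure algebra `D_F`: the `R`-subalgebra of `Q_W^F` generated by
`R⟦Λ⟧_F` and the `X_α`, `α ∈ Σ`. -/
def D : Subalgebra R (QW F P) :=
  Algebra.adjoin R
    ((Set.range fun u : FGA F Λ => SkewMonoidAlgebra.single 1 (algebraMap (FGA F Λ) (Q F P) u)) ∪
      Set.range (X F P))

end Demazure

section Hecke

variable {ι Λ Λ' Γ : Type*} [AddCommGroup Λ] [AddCommGroup Λ'] [AddCommGroup Γ]

/-- The base change of `F` to `R_F = R⟦Γ⟧_F`. -/
abbrev baseChange (F : FormalGroup R) (Γ : Type*) [AddCommGroup Γ] : FormalGroup (FGA F Γ) :=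
  F.map (algebraMap R (FGA F Γ))

/-- `R_F⟦Λ⟧_F`, where `R_F = R⟦Γ⟧_F`. -/
abbrev FGA₂ (F : FormalGroup R) (Γ Λ : Type*) [AddCommGroup Γ] [AddCommGroup Λ] : Type _ :=
  FGA (baseChange F Γ) Λ

variable (F : FormalGroup R) (P : RootDatum ι Λ Λ')

variable (Γ) in
/-- `κ_α = κ^F(x_α) ∈ R_F⟦Λ⟧_F`. -/
def kappaRoot (i : ι) : FGA₂ F Γ Λ :=
  FGA.eval (baseChange F Γ) (PowerSeries.map (algebraMap R (FGA F Γ)) (kappa F)) (P.root i)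

open Classical in
variable (Γ) in
/-- The element `κ_α` if `κ^F ≠ 0`, and `1` if `κ^F = 0`. -/
def kappaRoot' (i : ι) : FGA₂ F Γ Λ := if kappa F = 0 then 1 else kappaRoot Γ F P i

theorem smul_kappaRoot' (w : P.weylGroup) (i : ι) :
    ∃ j, w • kappaRoot' Γ F P i = kappaRoot' Γ F P j := by
  refine ⟨P.weylGroupToPerm w i, ?_⟩
  unfold kappaRoot'
  split_ifs
  · exact smul_one w
  · rw [kappaRoot, FGA.smul_eval, RootPairing.weylGroup_apply_root]; rfl

variable (Γ) in
/-- `R_F⟦Λ⟧_F^κ`, which is `R_F⟦Λ⟧_F` if `κ^F = 0` and `R_F⟦Λ⟧_F[1/κ_α | α ∈ Σ]` otherwise. -/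
abbrev FGAκ : Type _ := Loc (kappaRoot' Γ F P)

instance : MulSemiringAction P.weylGroup (FGAκ Γ F P) := Loc.action _ (smul_kappaRoot' F P)

instance : SMulCommClass P.weylGroup (FGA F Γ) (FGAκ Γ F P) :=
  Loc.action_smulCommClass _ (smul_kappaRoot' F P) (FGA F Γ)

variable (Γ) in
/-- The element `x_α` of `R_F⟦Λ⟧_F^κ`. -/
abbrev xRootκ (i : ι) : FGAκ Γ F P :=
  algebraMap (FGA₂ F Γ Λ) (FGAκ Γ F P) (xRoot (baseChange F Γ) P i)

theorem smul_xRootκ (w : P.weylGroup) (i : ι) : ∃ j, w • xRootκ Γ F P i = xRootκ Γ F P j := by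
  obtain ⟨j, hj⟩ := smul_xRoot (baseChange F Γ) P w i
  exact ⟨j, (Loc.action_algebraMap _ (smul_kappaRoot' F P) w _).trans (congrArg _ hj)⟩

variable (Γ) in
/-- `(Q^F)' = R_F⟦Λ⟧_F^κ[1/x_α | α ∈ Σ]`. -/
abbrev Q' : Type _ := Loc (xRootκ Γ F P)

instance : MulSemiringAction P.weylGroup (Q' Γ F P) := Loc.action _ (smul_xRootκ F P)

instance : SMulCommClass P.weylGroup (FGA F Γ) (Q' Γ F P) :=
  Loc.action_smulCommClass _ (smul_xRootκ F P) (FGA F Γ)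

variable (Γ) in
/-- The twisted formal group algebra `(Q_W^F)' = (Q^F)' ♯_{R_F} R_F[W]`. -/
abbrev QW' : Type _ := SkewMonoidAlgebra (Q' Γ F P) P.weylGroup

/-- `Θ_F = μ_F(x_γ) - μ_F(x_{-γ}) ∈ R_F`. -/
def Theta (γ : Γ) : FGA F Γ := FGA.eval F (mu F) γ - FGA.eval F (mu F) (-γ)

open Classical in
/-- `ϑ_α`, which is `2 x_γ` if `κ^F = 0` and `Θ_F / κ_α` otherwise. -/
def vartheta (γ : Γ) (i : ι) : FGAκ Γ F P :=
  if kappa F = 0 then algebraMap (FGA F Γ) (FGAκ Γ F P) (2 * FGA.x F γ)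
  else algebraMap (FGA F Γ) (FGAκ Γ F P) (Theta F γ) * Loc.inv (kappaRoot' Γ F P) i

open Classical in
/-- `ϖ`, which is `1` if `κ^F = 0` and `μ_F(x_γ)` otherwise. -/
def varpi (γ : Γ) : FGA F Γ := if kappa F = 0 then 1 else FGA.eval F (mu F) γ

/-- `T_α = ϑ_α X_α + ϖ δ_{s_α} ∈ (Q_W^F)'`. -/
def T (γ : Γ) (i : ι) : QW' Γ F P :=
  SkewMonoidAlgebra.single 1 (algebraMap (FGAκ Γ F P) (Q' Γ F P) (vartheta F P γ i)) *
      demazureElement (Loc.inv (xRootκ Γ F P) i) (RootPairing.weylGroup.ofIdx P i) +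
    SkewMonoidAlgebra.single (RootPairing.weylGroup.ofIdx P i)
      (algebraMap (FGA F Γ) (Q' Γ F P) (varpi F γ))

/-- The formal affine Hecke algebra `H_F`: the `R_F`-subalgebra of `(Q_W^F)'` generated by
`R_F⟦Λ⟧_F^κ` and the `T_α` for the simple roots `α`. -/
def H (b : P.Base) (γ : Γ) : Subalgebra (FGA F Γ) (QW' Γ F P) :=
  Algebra.adjoin (FGA F Γ)
    ((Set.range fun u : FGAκ Γ F P =>
        SkewMonoidAlgebra.single 1 (algebraMap (FGAκ Γ F P) (Q' Γ F P) u)) ∪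
      T F P γ '' b.support)

end Hecke

/-- `φ : R⟦Λ⟧_F ≃ S⟦Λ⟧_G` is the ring isomorphism given by `σ : R ≃ S` on coefficients and by the
substitution `x_λ ↦ g(x_λ)`: it has these values on coefficients and variables, and `φ` and its
inverse preserve the filtrations defining the topologies. Elements of `R[x_Λ]` being dense,
there is at most one such `φ`. -/
structure IsSubstitution {S Λ : Type*} [CommRing S] [AddCommGroup Λ] {F : FormalGroup R}
    {G : FormalGroup S} (σ : R ≃+* S) (g : PowerSeries S) (φ : FGA F Λ ≃+* FGA G Λ) : Prop where
  map_algebraMap : ∀ r : R, φ (algebraMap R (FGA F Λ) r) = algebraMap S (FGA G Λ) (σ r)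
  map_x : ∀ l : Λ, φ (FGA.x F l) = FGA.eval G g l
  mem_fil : ∀ (n : ℕ) (u : FGA F Λ), φ u ∈ FGA.fil G n ↔ u ∈ FGA.fil F n

end FormalHecke

end

/-!
The series `f` and `h` are mutually inverse isomorphisms of formal group laws between `F` and its
normalization `F̃`, and the formal inverse `ι` of `F̃`, by commutativity, is an automorphism of `F̃`
of order two. A homomorphism of formal group laws induces a continuous substitution homomorphism of
formal group algebras (`exists_isSubstitutionHom`): it is defined on the completed polynomial ring
degree by degree and respects the relations `x_{λ+λ'} = F(x_λ, x_λ')`. The formal group algebras are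
separated and polynomials are dense, so such a homomorphism is determined by its values on the
coefficients and the `x_λ` (`FGA.ringHom_ext`). Hence inverse series give inverse substitutions
(`exists_isSubstitution`), and substitutions commute with the Weyl group
(`IsSubstitutionHom.map_smul`).

As `f(x)` and `ι(x)` are of the form `x ⬝ unit`, these isomorphisms carry `x_α` to a unit times
`x_α`. They therefore extend to the localizations and to the twisted group algebras, and they match
the generators of the Demazure algebras up to such units (`exists_demazure_ringEquiv`).

For the Hecke algebras the units have to cancel exactly. From `μ_F = 1 - h` and
`μ_F(x) μ_F(ι_F(x)) = 1` one gets `ι(x) = x / (x - 1)`, so that `μ_{F̃}(x) = 1 / (1 - x)` and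
`κ^{F̃} = 1`. With `t(x) = f(ι(x))` it follows that `μ_F(t(x)) = μ_{F̃}(x)`
(`mu_subst_twist`) and, since `x κ^F(x) = 1 - 1 / μ_F(x)`, that `t(x) κ^F(t(x)) = x`
(`kappa_subst_twist_mul`). Thus `Θ_F` goes to `Θ_{F̃}`, `κ_α x_α` to `x_α` and `μ_F(x_γ)` to
`μ_{F̃}(x_γ)`, which says that `T_α` goes to `T_α` (`exists_hecke_ringEquiv`).
-/

noncomputable section

namespace FormalHecke

/-! ### Separation and density in formal group algebras -/

section Filtration

variable {R S : Type*} [CommRing R] [CommRing S] {Λ Λ' : Type*}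

theorem CPoly.ker_evalₐ_one_pow_le (n : ℕ) :
    RingHom.ker (AdicCompletion.evalₐ (MvPolynomial.idealOfVars Λ R) 1) ^ n ≤
      RingHom.ker (AdicCompletion.evalₐ (MvPolynomial.idealOfVars Λ R) n) := by
  rcases Nat.eq_zero_or_pos n with rfl | hn
  · intro z _
    obtain ⟨s, rfl⟩ := AdicCompletion.mk_surjective _ _ z
    rw [RingHom.mem_ker, AdicCompletion.evalₐ_mk, Ideal.Quotient.eq_zero_iff_mem, pow_zero,
      Ideal.one_eq_top]
    trivial
  · have h : RingHom.ker (AdicCompletion.evalₐ (MvPolynomial.idealOfVars Λ R) 1) ≤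
        ((MvPolynomial.idealOfVars Λ R).map
          (Ideal.Quotient.mk (MvPolynomial.idealOfVars Λ R ^ n))).comap
          (AdicCompletion.evalₐ (MvPolynomial.idealOfVars Λ R) n) := by
      intro z hz
      obtain ⟨s, rfl⟩ := AdicCompletion.mk_surjective _ _ z
      rw [RingHom.mem_ker, AdicCompletion.evalₐ_mk, Ideal.Quotient.eq_zero_iff_mem] at hz
      rw [Ideal.mem_comap, AdicCompletion.evalₐ_mk]
      refine Ideal.mem_map_of_mem _ ?_
      have h1 := AdicCompletion.Ideal.mk_eq_mk _ hn s
      rw [Ideal.Quotient.mk_eq_mk_iff_sub_mem] at h1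
      have := add_mem h1 hz
      simpa using this
    refine (Ideal.pow_right_mono h n).trans ?_
    refine (Ideal.le_comap_pow _ n).trans ?_
    rw [← Ideal.map_pow, Ideal.map_quotient_self]
    exact le_rfl

variable [AddCommGroup Λ] [AddCommGroup Λ'] (F : FormalGroup R) (G : FormalGroup S)

theorem FGA.fil_one_pow_le (n : ℕ) : FGA.fil F (Λ := Λ) 1 ^ n ≤ FGA.fil F n := by
  rw [FGA.fil, ← Ideal.map_pow]
  exact Ideal.map_mono (CPoly.ker_evalₐ_one_pow_le n)

variable {F} in
/-- The ideal `𝒥_F` being closed, `R⟦Λ⟧_F` is separated. -/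
theorem FGA.eq_of_forall_sub_mem_fil {u v : FGA F Λ} (h : ∀ n, u - v ∈ FGA.fil F n) : u = v := by
  obtain ⟨z, hz⟩ := FGA.mk_surjective F (u - v)
  rw [← sub_eq_zero, ← hz]
  refine Ideal.Quotient.eq_zero_iff_mem.2 ?_
  rw [relIdeal, CPoly.closure, Ideal.mem_iInf]
  intro n
  obtain ⟨y, hy, hyz⟩ := (Ideal.mem_map_iff_of_surjective _ (FGA.mk_surjective F)).1 (hz ▸ h n)
  have h1 : z - y ∈ relIdeal F Λ := Ideal.Quotient.eq.1 hyz.symm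
  rw [relIdeal, CPoly.closure, Ideal.mem_iInf] at h1
  simpa using add_mem (h1 n) (Ideal.mem_sup_right hy)

/-- Polynomials in the `x_λ` are dense in `R⟦Λ⟧_F`. -/
theorem FGA.exists_sub_mem_fil (u : FGA F Λ) (n : ℕ) :
    ∃ p : MvPolynomial Λ R, u - MvPolynomial.aeval (FGA.x F) p ∈ FGA.fil F n := by
  obtain ⟨z, rfl⟩ := FGA.mk_surjective F u
  obtain ⟨p, hp⟩ := Ideal.Quotient.mk_surjective (AdicCompletion.evalₐ _ n z)
  refine ⟨p, ?_⟩
  have e : MvPolynomial.aeval (FGA.x F) p =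
      FGA.mk F (AdicCompletion.of (MvPolynomial.idealOfVars Λ R) (MvPolynomial Λ R) p) := by
    have : MvPolynomial.aeval (FGA.x F) = (FGA.mk F).comp
        ((Algebra.ofId (MvPolynomial Λ R) (CPoly R Λ)).restrictScalars R) := by
      refine MvPolynomial.algHom_ext fun l => ?_
      rw [MvPolynomial.aeval_X]
      rfl
    rw [this]
    rfl
  rw [e, ← map_sub]
  refine Ideal.mem_map_of_mem _ ?_
  rw [RingHom.mem_ker, map_sub, AdicCompletion.evalₐ_of, hp, sub_self]

variable {F G}

/-- Continuous ring homomorphisms out of `R⟦Λ⟧_F` are determined by their values on the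
coefficients and on the `x_λ`. -/
theorem FGA.ringHom_ext {φ ψ : FGA F Λ →+* FGA G Λ'}
    (hφ : ∀ (n : ℕ) (u : FGA F Λ), u ∈ FGA.fil F n → φ u ∈ FGA.fil G n)
    (hψ : ∀ (n : ℕ) (u : FGA F Λ), u ∈ FGA.fil F n → ψ u ∈ FGA.fil G n)
    (hC : ∀ r : R, φ (algebraMap R (FGA F Λ) r) = ψ (algebraMap R (FGA F Λ) r))
    (hx : ∀ l : Λ, φ (FGA.x F l) = ψ (FGA.x F l)) : φ = ψ := by
  ext u
  refine FGA.eq_of_forall_sub_mem_fil fun n => ?_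
  obtain ⟨p, hp⟩ := FGA.exists_sub_mem_fil F u n
  have e : φ (MvPolynomial.aeval (FGA.x F) p) = ψ (MvPolynomial.aeval (FGA.x F) p) := by
    have : φ.comp (MvPolynomial.aeval (R := R) (FGA.x F)).toRingHom =
        ψ.comp (MvPolynomial.aeval (R := R) (FGA.x F)).toRingHom := by
      refine MvPolynomial.ringHom_ext (fun r => ?_) fun l => ?_
      · simpa using hC r
      · simpa using hx l
    exact RingHom.congr_fun this p
  have := sub_mem (hφ n _ hp) (hψ n _ hp)
  rwa [map_sub, map_sub, e, sub_sub_sub_cancel_right] at this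

end Filtration

section PowerSeriesEvaluation

variable {R S : Type*} [CommRing R] [CommRing S] {Λ Λ' : Type*} [AddCommGroup Λ] [AddCommGroup Λ']
  {σ τ : Type*} [Finite σ] [Finite τ]

/-- In finitely many variables, the series of order at least `n` form the `n`-th power of the ideal
generated by the variables. -/
theorem sub_truncTotal_mem_span_X_pow (p : MvPowerSeries σ R) (n : ℕ) :
    p - (p.truncTotal n : MvPolynomial σ R) ∈
      (Ideal.span (Set.range MvPowerSeries.X) : Ideal (MvPowerSeries σ R)) ^ n := by
  have h : MvPowerSeries.toAdicCompletion σ R (p - (p.truncTotal n : MvPolynomial σ R)) ∈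
      (AdicCompletion.eval (MvPolynomial.idealOfVars σ R) (MvPolynomial σ R) n).ker := by
    rw [LinearMap.mem_ker, map_sub, MvPowerSeries.toAdicCompletion_coe, map_sub, sub_eq_zero]
    rfl
  rw [← AdicCompletion.pow_smul_top_eq_ker_eval (MvPolynomial.idealOfVars_fg σ R)] at h
  have h2 : p - (p.truncTotal n : MvPolynomial σ R) ∈
      (MvPolynomial.idealOfVars σ R ^ n • ⊤ :
        Submodule (MvPolynomial σ R) (MvPowerSeries σ R)) := by
    have := Submodule.mem_map_of_mem
      (f := (MvPowerSeries.toAdicCompletionAlgEquiv σ R).symm.toLinearMap) h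
    rw [Submodule.map_smul''] at this
    have e : (MvPowerSeries.toAdicCompletionAlgEquiv σ R).symm.toLinearMap
        (MvPowerSeries.toAdicCompletion σ R (p - (p.truncTotal n : MvPolynomial σ R))) =
        p - (p.truncTotal n : MvPolynomial σ R) :=
      (MvPowerSeries.toAdicCompletionAlgEquiv σ R).symm_apply_apply _
    rw [← e]
    exact Submodule.smul_mono le_rfl le_top this
  rw [Ideal.smul_top_eq_map, Submodule.restrictScalars_mem, Ideal.map_pow] at h2
  refine Ideal.pow_right_mono ?_ n h2
  rw [Ideal.map_span, Ideal.span_le]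
  rintro _ ⟨_, ⟨i, rfl⟩, rfl⟩
  refine Ideal.subset_span ⟨i, ?_⟩
  rw [MvPowerSeries.algebraMap_apply', MvPolynomial.coe_X]
  simp

theorem truncTotal_one_eq_zero {p : MvPowerSeries σ R} (hp : p.constantCoeff = 0) :
    p.truncTotal 1 = 0 := by
  ext m
  by_cases hm : m.degree < 1
  · have : m = 0 := (Finsupp.degree_eq_zero_iff m).1 (by omega)
    rw [MvPowerSeries.coeff_truncTotal _ hm, this]
    simpa using hp
  · rw [MvPowerSeries.coeff_truncTotal_eq_zero _ (not_lt.1 hm)]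
    simp

/-- Ring homomorphisms from a power series ring in finitely many variables to `S⟦Λ⟧_G` which send
the variables into the augmentation ideal are automatically continuous, hence determined by their
values on constants and variables. -/
theorem FGA.ringHom_ext_mvPowerSeries {G : FormalGroup S} {φ ψ : MvPowerSeries σ R →+* FGA G Λ}
    (hC : ∀ r : R, φ (MvPowerSeries.C r) = ψ (MvPowerSeries.C r))
    (hX : ∀ i, φ (MvPowerSeries.X i) = ψ (MvPowerSeries.X i))
    (h1 : ∀ i, ψ (MvPowerSeries.X i) ∈ FGA.fil G 1) : φ = ψ := by
  have key (θ : MvPowerSeries σ R →+* FGA G Λ) (hθ : ∀ i, θ (MvPowerSeries.X i) ∈ FGA.fil G 1)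
      (n : ℕ) (q : MvPowerSeries σ R)
      (hq : q ∈ (Ideal.span (Set.range MvPowerSeries.X) : Ideal (MvPowerSeries σ R)) ^ n) :
      θ q ∈ FGA.fil G n := by
    have h : (Ideal.span (Set.range MvPowerSeries.X) : Ideal (MvPowerSeries σ R)) ≤
        (FGA.fil G 1).comap θ := by
      rw [Ideal.span_le]
      rintro _ ⟨i, rfl⟩
      exact hθ i
    exact FGA.fil_one_pow_le G n (Ideal.le_comap_pow θ n (Ideal.pow_right_mono h n hq))
  ext p
  refine FGA.eq_of_forall_sub_mem_fil fun n => ?_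
  have hp := sub_truncTotal_mem_span_X_pow p n
  have e : φ (p.truncTotal n : MvPolynomial σ R) = ψ (p.truncTotal n : MvPolynomial σ R) := by
    have : φ.comp MvPolynomial.coeToMvPowerSeries.ringHom =
        ψ.comp MvPolynomial.coeToMvPowerSeries.ringHom := by
      refine MvPolynomial.ringHom_ext (fun r => ?_) fun i => ?_
      · simpa using hC r
      · simpa using hX i
    exact RingHom.congr_fun this _
  have := sub_mem (key φ (fun i => hX i ▸ h1 i) n _ hp) (key ψ h1 n _ hp)
  rwa [map_sub, map_sub, e, sub_sub_sub_cancel_right] at this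

variable (F : FormalGroup R) (G : FormalGroup S)

/-- The evaluation `p ↦ p(x_{v(i)})` of power series in finitely many variables in `R⟦Λ⟧_F`. -/
def FGA.subst (v : σ → Λ) : MvPowerSeries σ R →ₐ[R] FGA F Λ :=
  ((FGA.mk F).comp (CPoly.map v)).comp ((MvPowerSeries.toAdicCompletion σ R).restrictScalars R)

theorem FGA.mk_substVars (v : σ → Λ) (p : MvPowerSeries σ R) :
    FGA.mk F (CPoly.substVars v p) = FGA.subst F v p := rfl

theorem FGA.subst_X (v : σ → Λ) (i : σ) :
    FGA.subst F v (MvPowerSeries.X i) = FGA.x F (v i) := by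
  rw [← FGA.mk_substVars, FGA.x, ← CPoly.map_var, CPoly.substVars, ← MvPolynomial.coe_X,
    MvPowerSeries.toAdicCompletion_coe]
  rfl

theorem FGA.subst_C (v : σ → Λ) (r : R) :
    FGA.subst F v (MvPowerSeries.C r) = algebraMap R (FGA F Λ) r :=
  (FGA.subst F v).commutes r

theorem FGA.x_mem_fil_one (l : Λ) : FGA.x F l ∈ FGA.fil F 1 := by
  refine Ideal.mem_map_of_mem _ ?_
  rw [RingHom.mem_ker, CPoly.var, AdicCompletion.evalₐ_of, Ideal.Quotient.eq_zero_iff_mem, pow_one]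
  exact Ideal.subset_span ⟨l, rfl⟩

theorem FGA.subst_mem_fil_one (v : σ → Λ) {p : MvPowerSeries σ R} (hp : p.constantCoeff = 0) :
    FGA.subst F v p ∈ FGA.fil F 1 := by
  have h := sub_truncTotal_mem_span_X_pow p 1
  rw [truncTotal_one_eq_zero hp, MvPolynomial.coe_zero, sub_zero, pow_one] at h
  have h2 : (Ideal.span (Set.range MvPowerSeries.X) : Ideal (MvPowerSeries σ R)) ≤
      (FGA.fil F 1).comap (FGA.subst F v) := by
    rw [Ideal.span_le]
    rintro _ ⟨i, rfl⟩
    rw [SetLike.mem_coe, Ideal.mem_comap, FGA.subst_X]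
    exact FGA.x_mem_fil_one F (v i)
  exact h2 h

variable {G}

/-- A ring homomorphism from a power series ring to `S⟦Λ⟧_G` with values `σ` on the coefficients
and `aᵢ(x)` on the variables is the substitution of the `aᵢ`. -/
theorem FGA.eq_subst_of_apply_X {υ : Type*} [Finite υ] (ψ : MvPowerSeries τ R →+* FGA G Λ)
    (s : R →+* S) (hC : ∀ r, ψ (MvPowerSeries.C r) = algebraMap S (FGA G Λ) (s r))
    (v : υ → Λ) {a : τ → MvPowerSeries υ S} (ha : ∀ i, (a i).constantCoeff = 0)
    (hX : ∀ i, ψ (MvPowerSeries.X i) = FGA.subst G v (a i)) (p : MvPowerSeries τ R) :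
    ψ p = FGA.subst G v ((MvPowerSeries.map s p).subst a) := by
  have hs := MvPowerSeries.hasSubst_of_constantCoeff_zero ha
  have : ψ = ((FGA.subst G v).toRingHom.comp (MvPowerSeries.substAlgHom hs).toRingHom).comp
      (MvPowerSeries.map s) := by
    refine FGA.ringHom_ext_mvPowerSeries (fun r => ?_) (fun i => ?_) fun i => ?_
    · simp only [RingHom.comp_apply, AlgHom.toRingHom_eq_coe, RingHom.coe_coe, MvPowerSeries.map_C,
        MvPowerSeries.coe_substAlgHom, MvPowerSeries.subst_C, FGA.subst_C, hC]
    · simp only [RingHom.comp_apply, AlgHom.toRingHom_eq_coe, RingHom.coe_coe, MvPowerSeries.map_X,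
        MvPowerSeries.coe_substAlgHom, MvPowerSeries.subst_X hs, hX]
    · simp only [RingHom.comp_apply, AlgHom.toRingHom_eq_coe, RingHom.coe_coe, MvPowerSeries.map_X,
        MvPowerSeries.coe_substAlgHom, MvPowerSeries.subst_X hs]
      exact FGA.subst_mem_fil_one G v (ha i)
  rw [this, RingHom.comp_apply, RingHom.comp_apply]
  simp

end PowerSeriesEvaluation

/-! ### Substitution homomorphisms -/

section CompletedPolynomials

variable {R S Λ : Type*} [CommRing R] [CommRing S]

/-- The map `R[x_Λ] → S⟦x_Λ⟧` given by `s` on the coefficients and `x_λ ↦ g(x_λ)`. -/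
def CPoly.substPoly (s : R →+* S) (g : PowerSeries S) (Λ : Type*) :
    MvPolynomial Λ R →+* CPoly S Λ :=
  MvPolynomial.eval₂Hom ((algebraMap S (CPoly S Λ)).comp s)
    fun l => CPoly.substVars (fun _ : Unit => l) g

theorem CPoly.evalₐ_one_substVars (g : PowerSeries S) (hg : g.constantCoeff = 0) (l : Λ) :
    AdicCompletion.evalₐ (MvPolynomial.idealOfVars Λ S) 1
      (CPoly.substVars (fun _ : Unit => l) g) = 0 := by
  obtain ⟨t, ht⟩ := AdicCompletion.mk_surjective _ _ (MvPowerSeries.toAdicCompletion Unit S g)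
  rw [CPoly.substVars, ← ht, CPoly.evalₐ_map_mk, Ideal.Quotient.eq_zero_iff_mem]
  refine idealOfVars_pow_le_comap_rename _ 1 ?_
  have h := congrArg (AdicCompletion.evalₐ _ 1) ht
  rw [AdicCompletion.evalₐ_mk] at h
  rw [← Ideal.Quotient.eq_zero_iff_mem, h]
  have e : AdicCompletion.evalₐ (MvPolynomial.idealOfVars Unit S) 1
      (MvPowerSeries.toAdicCompletion Unit S g) =
        Ideal.Quotient.mk _ (MvPowerSeries.truncTotal 1 g) := rfl
  rw [e, truncTotal_one_eq_zero hg, map_zero]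

theorem CPoly.idealOfVars_pow_le_comap_substPoly (s : R →+* S) (g : PowerSeries S)
    (hg : g.constantCoeff = 0) (n : ℕ) :
    MvPolynomial.idealOfVars Λ R ^ n ≤
      (RingHom.ker (AdicCompletion.evalₐ (MvPolynomial.idealOfVars Λ S) n)).comap
        (CPoly.substPoly s g Λ) := by
  refine le_trans ?_ (Ideal.comap_mono (CPoly.ker_evalₐ_one_pow_le n))
  refine le_trans (Ideal.pow_right_mono ?_ n) (Ideal.le_comap_pow _ n)
  rw [Ideal.span_le]
  rintro _ ⟨l, rfl⟩
  rw [SetLike.mem_coe, Ideal.mem_comap, CPoly.substPoly, MvPolynomial.coe_eval₂Hom,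
    MvPolynomial.eval₂_X]
  exact CPoly.evalₐ_one_substVars g hg l

/-- The reduction modulo degree `n` of the map `R⟦x_Λ⟧ → S⟦x_Λ⟧`, `x_λ ↦ g(x_λ)`. -/
def CPoly.substAux (s : R →+* S) (g : PowerSeries S) (hg : g.constantCoeff = 0) (n : ℕ) :
    CPoly R Λ →+* MvPolynomial Λ S ⧸ MvPolynomial.idealOfVars Λ S ^ n :=
  (Ideal.Quotient.lift (MvPolynomial.idealOfVars Λ R ^ n)
    ((AdicCompletion.evalₐ (MvPolynomial.idealOfVars Λ S) n).toRingHom.comp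
      (CPoly.substPoly s g Λ))
    fun _ hp => CPoly.idealOfVars_pow_le_comap_substPoly s g hg n hp).comp
      (AdicCompletion.evalₐ (MvPolynomial.idealOfVars Λ R) n).toRingHom

theorem CPoly.substAux_mk (s : R →+* S) (g : PowerSeries S) (hg : g.constantCoeff = 0) (n : ℕ)
    (t : AdicCompletion.AdicCauchySequence (MvPolynomial.idealOfVars Λ R) (MvPolynomial Λ R)) :
    CPoly.substAux s g hg n (AdicCompletion.mk _ _ t) =
      AdicCompletion.evalₐ _ n (CPoly.substPoly s g Λ (t n)) := by
  simp [CPoly.substAux]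

theorem CPoly.factorPow_evalₐ {m n : ℕ} (hle : m ≤ n) (z : CPoly R Λ) :
    Ideal.Quotient.factorPow (MvPolynomial.idealOfVars Λ R) hle (AdicCompletion.evalₐ _ n z) =
      AdicCompletion.evalₐ _ m z := by
  obtain ⟨t, rfl⟩ := AdicCompletion.mk_surjective _ _ z
  rw [AdicCompletion.evalₐ_mk, AdicCompletion.evalₐ_mk]
  exact (AdicCompletion.Ideal.mk_eq_mk _ hle t)

theorem CPoly.substAux_compat (s : R →+* S) (g : PowerSeries S) (hg : g.constantCoeff = 0)
    {m n : ℕ} (hle : m ≤ n) :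
    (Ideal.Quotient.factorPow (MvPolynomial.idealOfVars Λ S) hle).comp
      (CPoly.substAux s g hg n) = CPoly.substAux s g hg m := by
  ext z
  obtain ⟨t, rfl⟩ := AdicCompletion.mk_surjective _ _ z
  rw [RingHom.comp_apply, CPoly.substAux_mk, CPoly.substAux_mk, CPoly.factorPow_evalₐ,
    ← sub_eq_zero, ← map_sub, ← map_sub]
  refine CPoly.idealOfVars_pow_le_comap_substPoly s g hg m ?_
  have h := AdicCompletion.Ideal.mk_eq_mk _ hle t
  rwa [Ideal.Quotient.mk_eq_mk_iff_sub_mem] at h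

/-- The continuous map `R⟦x_Λ⟧ → S⟦x_Λ⟧` given by `s` on the coefficients and `x_λ ↦ g(x_λ)`. -/
def CPoly.substHom (s : R →+* S) (g : PowerSeries S) (hg : g.constantCoeff = 0) :
    CPoly R Λ →+* CPoly S Λ :=
  AdicCompletion.liftRingHom (MvPolynomial.idealOfVars Λ S) (CPoly.substAux s g hg)
    (CPoly.substAux_compat s g hg)

theorem CPoly.evalₐ_substHom (s : R →+* S) (g : PowerSeries S) (hg : g.constantCoeff = 0) (n : ℕ)
    (z : CPoly R Λ) :
    AdicCompletion.evalₐ _ n (CPoly.substHom s g hg z) = CPoly.substAux s g hg n z :=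
  AdicCompletion.evalₐ_liftRingHom _ _ (CPoly.substAux_compat s g hg) n z

theorem CPoly.substHom_of (s : R →+* S) (g : PowerSeries S) (hg : g.constantCoeff = 0)
    (p : MvPolynomial Λ R) :
    CPoly.substHom s g hg (AdicCompletion.of (MvPolynomial.idealOfVars Λ R) _ p) =
      CPoly.substPoly s g Λ p :=
  AdicCompletion.ext_evalₐ fun n => by
    rw [CPoly.evalₐ_substHom]
    simp [CPoly.substAux]

theorem CPoly.substHom_var (s : R →+* S) (g : PowerSeries S) (hg : g.constantCoeff = 0)
    (l : Λ) : CPoly.substHom s g hg (CPoly.var l) = CPoly.substVars (fun _ : Unit => l) g := by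
  rw [CPoly.var, CPoly.substHom_of, CPoly.substPoly, MvPolynomial.coe_eval₂Hom,
    MvPolynomial.eval₂_X]

theorem CPoly.substHom_algebraMap (s : R →+* S) (g : PowerSeries S) (hg : g.constantCoeff = 0)
    (r : R) : CPoly.substHom s g hg (algebraMap R (CPoly R Λ) r) = algebraMap S _ (s r) := by
  have := CPoly.substHom_of s g hg (MvPolynomial.C (σ := Λ) r)
  rw [CPoly.substPoly, MvPolynomial.coe_eval₂Hom, MvPolynomial.eval₂_C] at this
  exact this

theorem CPoly.substHom_mem_ker_evalₐ (s : R →+* S) (g : PowerSeries S) (hg : g.constantCoeff = 0)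
    {n : ℕ} {z : CPoly R Λ}
    (hz : z ∈ RingHom.ker (AdicCompletion.evalₐ (MvPolynomial.idealOfVars Λ R) n)) :
    CPoly.substHom s g hg z ∈
      RingHom.ker (AdicCompletion.evalₐ (MvPolynomial.idealOfVars Λ S) n) := by
  obtain ⟨t, rfl⟩ := AdicCompletion.mk_surjective _ _ z
  rw [RingHom.mem_ker, AdicCompletion.evalₐ_mk, Ideal.Quotient.eq_zero_iff_mem] at hz
  rw [RingHom.mem_ker, CPoly.evalₐ_substHom, CPoly.substAux_mk]
  exact CPoly.idealOfVars_pow_le_comap_substPoly s g hg n hz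

end CompletedPolynomials

section Substitution

variable {R S T : Type*} [CommRing R] [CommRing S] [CommRing T]
  {Λ : Type*} [AddCommGroup Λ] {F : FormalGroup R} {G : FormalGroup S} {K : FormalGroup T}

variable (F) in
theorem FGA.x_zero : FGA.x F (0 : Λ) = 0 := by
  refine Ideal.Quotient.eq_zero_iff_mem.2 ?_
  rw [relIdeal, CPoly.closure, Ideal.mem_iInf]
  exact fun n => Ideal.mem_sup_left (Ideal.subset_span (Or.inl rfl))

variable (F) in
theorem FGA.x_add (l l' : Λ) : FGA.x F (l + l') = FGA.subst F ![l, l'] F.toPowerSeries := by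
  refine Ideal.Quotient.eq.2 ?_
  rw [relIdeal, CPoly.closure, Ideal.mem_iInf]
  exact fun n => Ideal.mem_sup_left (Ideal.subset_span (Or.inr ⟨(l, l'), rfl⟩))

variable (F) in
/-- If `x_l = p(x)`, then `(g ∘ p)(x) = g(x_l)`. -/
theorem FGA.subst_powerSeries_subst {υ : Type*} [Finite υ] (v : υ → Λ) {l : Λ}
    {p : MvPowerSeries υ R} (hp : p.constantCoeff = 0) (hl : FGA.x F l = FGA.subst F v p)
    (g : PowerSeries R) : FGA.subst F v (g.subst p) = FGA.eval F g l := by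
  have := FGA.eq_subst_of_apply_X (FGA.subst F (fun _ : Unit => l)).toRingHom (RingHom.id R)
    (FGA.subst_C F _) v (a := fun _ => p) (fun _ => hp) (fun _ => (FGA.subst_X F _ _).trans hl) g
  rw [MvPowerSeries.map_id] at this
  exact this.symm

theorem constantCoeff_subst_X {τ : Type*} (g : PowerSeries R) (hg : g.constantCoeff = 0) (i : τ) :
    (g.subst (MvPowerSeries.X i : MvPowerSeries τ R) : MvPowerSeries τ R).constantCoeff = 0 :=
  PowerSeries.constantCoeff_subst_eq_zero (MvPowerSeries.constantCoeff_X i) g hg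

variable (F) in
theorem FGA.subst_subst_X {υ : Type*} [Finite υ] (v : υ → Λ) (g : PowerSeries R) (i : υ) :
    FGA.subst F v (g.subst (MvPowerSeries.X i)) = FGA.eval F g (v i) :=
  FGA.subst_powerSeries_subst F v (MvPowerSeries.constantCoeff_X i) (FGA.subst_X F v i).symm g

theorem FGA.eval_zero_of_constantCoeff {g : PowerSeries R} (hg : g.constantCoeff = 0) :
    FGA.eval F g (0 : Λ) = 0 := by
  rw [← FGA.subst_powerSeries_subst F (fun _ : Unit => (0 : Λ)) (p := 0) (map_zero _)
    (by rw [map_zero, FGA.x_zero]), PowerSeries.subst_zero_of_constantCoeff_zero hg, map_zero]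

/-- `φ : R⟦Λ⟧_F → S⟦Λ⟧_G` is the continuous ring homomorphism given by `s` on the coefficients and
by the substitution `x_λ ↦ g(x_λ)`. -/
structure IsSubstitutionHom (s : R →+* S) (g : PowerSeries S) (φ : FGA F Λ →+* FGA G Λ) :
    Prop where
  map_algebraMap : ∀ r : R, φ (algebraMap R (FGA F Λ) r) = algebraMap S (FGA G Λ) (s r)
  map_x : ∀ l : Λ, φ (FGA.x F l) = FGA.eval G g l
  map_mem_fil : ∀ (n : ℕ) (u : FGA F Λ), u ∈ FGA.fil F n → φ u ∈ FGA.fil G n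

variable {s : R →+* S} {g : PowerSeries S} {φ : FGA F Λ →+* FGA G Λ}

theorem IsSubstitutionHom.map_eval (h : IsSubstitutionHom s g φ) (hg : g.constantCoeff = 0)
    (k : PowerSeries R) (l : Λ) :
    φ (FGA.eval F k l) = FGA.eval G ((PowerSeries.map s k).subst g) l :=
  FGA.eq_subst_of_apply_X (φ.comp (FGA.subst F (fun _ : Unit => l)).toRingHom) s
    (fun r => (congrArg φ (FGA.subst_C F _ r)).trans (h.map_algebraMap r)) (fun _ : Unit => l)
    (a := fun _ => g) (fun _ => hg)
    (fun _ => (congrArg φ (FGA.subst_X F _ _)).trans (h.map_x l)) k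

theorem IsSubstitutionHom.comp {t : S →+* T} {k : PowerSeries T} {ψ : FGA G Λ →+* FGA K Λ}
    (hψ : IsSubstitutionHom t k ψ) (hk : k.constantCoeff = 0) (hφ : IsSubstitutionHom s g φ) :
    IsSubstitutionHom (t.comp s) ((PowerSeries.map t g).subst k) (ψ.comp φ) where
  map_algebraMap r := by simp [hφ.map_algebraMap, hψ.map_algebraMap]
  map_x l := by rw [RingHom.comp_apply, hφ.map_x, hψ.map_eval hk]
  map_mem_fil n u hu := hψ.map_mem_fil n _ (hφ.map_mem_fil n u hu)

theorem FGA.eval_X (l : Λ) : FGA.eval F PowerSeries.X l = FGA.x F l :=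
  FGA.subst_X F _ _

theorem IsSubstitutionHom.eq_id {ψ : FGA F Λ →+* FGA F Λ}
    (h : IsSubstitutionHom (RingHom.id R) PowerSeries.X ψ) : ψ = RingHom.id _ :=
  FGA.ringHom_ext h.map_mem_fil (fun _ _ hu => hu) h.map_algebraMap
    fun l => (h.map_x l).trans (FGA.eval_X l)

/-- A homomorphism of formal group laws `g : G → s_*F`, that is, a series with `g(0) = 0` and
`(s_*F)(g(x), g(y)) = g(G(x, y))`, induces a continuous homomorphism `R⟦Λ⟧_F → S⟦Λ⟧_G`. -/
theorem exists_isSubstitutionHom (F : FormalGroup R) (G : FormalGroup S) (s : R →+* S)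
    (g : PowerSeries S) (hg : g.constantCoeff = 0)
    (h : (F.map s).toPowerSeries.subst
        ![(g.subst (MvPowerSeries.X 0 : MvPowerSeries (Fin 2) S) : MvPowerSeries (Fin 2) S),
          g.subst (MvPowerSeries.X 1 : MvPowerSeries (Fin 2) S)] = g.subst G.toPowerSeries) :
    ∃ φ : FGA F Λ →+* FGA G Λ, IsSubstitutionHom s g φ := by
  let χ : CPoly R Λ →+* FGA G Λ := (FGA.mk G).toRingHom.comp (CPoly.substHom s g hg)
  have hvar (l : Λ) : χ (CPoly.var l) = FGA.eval G g l :=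
    congrArg (FGA.mk G) (CPoly.substHom_var s g hg l)
  have hC (r : R) : χ (algebraMap R (CPoly R Λ) r) = algebraMap S (FGA G Λ) (s r) :=
    (congrArg (FGA.mk G) (CPoly.substHom_algebraMap s g hg r)).trans ((FGA.mk G).commutes _)
  have hfil {n : ℕ} {z : CPoly R Λ}
      (hz : z ∈ RingHom.ker (AdicCompletion.evalₐ (MvPolynomial.idealOfVars Λ R) n)) :
      χ z ∈ FGA.fil G n := Ideal.mem_map_of_mem _ (CPoly.substHom_mem_ker_evalₐ s g hg hz)
  have hrel (l l' : Λ) : χ (CPoly.substVars ![l, l'] F.toPowerSeries) = FGA.eval G g (l + l') := by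
    have e := FGA.eq_subst_of_apply_X (χ.comp ((CPoly.map ![l, l']).toRingHom.comp
      (((MvPowerSeries.toAdicCompletion (Fin 2) R).restrictScalars R).toRingHom))) s
      (fun r => by
        refine Eq.trans (congrArg χ ?_) (hC r)
        exact ((CPoly.map ![l, l']).comp
          ((MvPowerSeries.toAdicCompletion (Fin 2) R).restrictScalars R)).commutes r)
      ![l, l'] (a := fun i => g.subst (MvPowerSeries.X i)) (constantCoeff_subst_X g hg)
      (fun i => by
        rw [FGA.subst_subst_X, ← hvar]
        refine congrArg χ ?_
        rw [← CPoly.map_var]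
        refine congrArg (CPoly.map ![l, l']) ?_
        rw [← MvPolynomial.coe_X]
        exact MvPowerSeries.toAdicCompletion_coe _) F.toPowerSeries
    refine e.trans ?_
    rw [← FGA.subst_powerSeries_subst G ![l, l'] G.zero_constantCoeff (FGA.x_add G l l'), ← h,
      FormalGroup.map_toPowerSeries]
    congr 2
    funext i
    fin_cases i <;> rfl
  have hker : ∀ z ∈ relIdeal F Λ, χ z = 0 := by
    intro z hz
    refine FGA.eq_of_forall_sub_mem_fil fun n => ?_
    rw [sub_zero]
    rw [relIdeal, CPoly.closure, Ideal.mem_iInf] at hz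
    obtain ⟨a, ha, b, hb, rfl⟩ := Submodule.mem_sup.1 (hz n)
    have ha' : χ a = 0 := by
      rw [← RingHom.mem_ker]
      refine (Ideal.span_le.2 ?_ : _ ≤ RingHom.ker χ) ha
      rintro _ (rfl | ⟨p, rfl⟩)
      · rw [SetLike.mem_coe, RingHom.mem_ker, hvar, FGA.eval_zero_of_constantCoeff hg]
      · rw [SetLike.mem_coe, RingHom.mem_ker, map_sub, hvar, hrel, sub_self]
    rw [map_add, ha', zero_add]
    exact hfil hb
  refine ⟨Ideal.Quotient.lift (relIdeal F Λ) χ hker, hC, hvar, fun n u hu => ?_⟩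
  obtain ⟨z, hz, rfl⟩ := (Ideal.mem_map_iff_of_surjective _ (FGA.mk_surjective F)).1 hu
  exact hfil hz

end Substitution

/-! ### The formal inverse and the normalization -/

section FormalInverse

variable {R : Type*} [CommRing R] {σ : Type*} (F : FormalGroup R)

theorem constantCoeff_formalInverse_subst {p : MvPowerSeries σ R} (hp : p.constantCoeff = 0) :
    ((formalInverse F).subst p : MvPowerSeries σ R).constantCoeff = 0 :=
  PowerSeries.constantCoeff_subst_eq_zero hp _ (constantCoeff_formalInverse F)

theorem subst_self_formalInverse_subst {p : MvPowerSeries σ R} (hp : p.constantCoeff = 0) :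
    F.toPowerSeries.subst ![p, (formalInverse F).subst p] = 0 := by
  have hp' := PowerSeries.HasSubst.of_constantCoeff_zero hp
  have h := congrArg (PowerSeries.subst p) (subst_formalInverse F)
  rw [PowerSeries.subst, MvPowerSeries.subst_comp_subst_apply
    (hasSubst_X_cons (constantCoeff_formalInverse F)) hp'.const, ← PowerSeries.coe_substAlgHom hp',
    map_zero] at h
  rw [← h]
  congr 1
  funext i
  fin_cases i
  · exact (PowerSeries.subst_X hp').symm
  · rfl

variable [F.IsComm]

/-- The formal inverse is characterized by `F(p, ι_F(p)) = 0`. -/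
theorem eq_formalInverse_subst {p q : MvPowerSeries σ R} (hp : p.constantCoeff = 0)
    (hq : q.constantCoeff = 0) (h : F.toPowerSeries.subst ![p, q] = 0) :
    q = (formalInverse F).subst p := by
  let P : F.Point σ := ⟨p, PowerSeries.HasSubst.of_constantCoeff_zero hp⟩
  let Q : F.Point σ := ⟨q, PowerSeries.HasSubst.of_constantCoeff_zero hq⟩
  let P' : F.Point σ := ⟨(formalInverse F).subst p,
    PowerSeries.HasSubst.of_constantCoeff_zero (constantCoeff_formalInverse_subst F hp)⟩
  have h1 : P + Q = 0 := Subtype.ext h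
  have h2 : P + P' = 0 := Subtype.ext (subst_self_formalInverse_subst F hp)
  have h3 : Q = P' := left_neg_eq_right_neg ((add_comm Q P).trans h1) h2
  exact congrArg Subtype.val h3

theorem formalInverse_subst_formalInverse :
    (formalInverse F).subst (formalInverse F) = (PowerSeries.X : PowerSeries R) := by
  have hX : (PowerSeries.X : PowerSeries R).constantCoeff = 0 := PowerSeries.constantCoeff_X
  have hi := constantCoeff_formalInverse F
  refine (eq_formalInverse_subst F hi hX ?_).symm
  rw [F.comm' (PowerSeries.HasSubst.of_constantCoeff_zero hi)
    (PowerSeries.HasSubst.of_constantCoeff_zero hX), subst_formalInverse]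

/-- As `F` is commutative, its formal inverse is an endomorphism of `F`. -/
theorem subst_formalInverse_pair {p q : MvPowerSeries σ R} (hp : p.constantCoeff = 0)
    (hq : q.constantCoeff = 0) :
    F.toPowerSeries.subst ![(formalInverse F).subst p, (formalInverse F).subst q] =
      ((formalInverse F).subst (F.toPowerSeries.subst ![p, q] : MvPowerSeries σ R) :
        MvPowerSeries σ R) := by
  have hp' := constantCoeff_formalInverse_subst F hp
  have hq' := constantCoeff_formalInverse_subst F hq
  refine eq_formalInverse_subst F (constantCoeff_subst_pair F hp hq)
    (constantCoeff_subst_pair F hp' hq') ?_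
  let P : F.Point σ := ⟨p, PowerSeries.HasSubst.of_constantCoeff_zero hp⟩
  let Q : F.Point σ := ⟨q, PowerSeries.HasSubst.of_constantCoeff_zero hq⟩
  let P' : F.Point σ := ⟨_, PowerSeries.HasSubst.of_constantCoeff_zero hp'⟩
  let Q' : F.Point σ := ⟨_, PowerSeries.HasSubst.of_constantCoeff_zero hq'⟩
  have h1 : P + P' = 0 := Subtype.ext (subst_self_formalInverse_subst F hp)
  have h2 : Q + Q' = 0 := Subtype.ext (subst_self_formalInverse_subst F hq)
  have h3 : P + Q + (P' + Q') = 0 := by rw [add_add_add_comm, h1, h2, add_zero]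
  exact congrArg Subtype.val h3

theorem X_mul_cancel {p q : PowerSeries R} (h : PowerSeries.X * p = PowerSeries.X * q) : p = q := by
  ext n
  simpa using congrArg (PowerSeries.coeff (n + 1)) h

/-- `μ_F(x) μ_F(ι_F(x)) = 1`, which is `ι_F(ι_F(x)) = x` divided by `x`. -/
theorem mu_mul_mu_subst_formalInverse : mu F * (mu F).subst (formalInverse F) = 1 := by
  have hi := PowerSeries.HasSubst.of_constantCoeff_zero' (constantCoeff_formalInverse F)
  have h := congrArg (PowerSeries.substAlgHom hi) (X_mul_mu F)
  rw [map_mul, map_neg, PowerSeries.substAlgHom_X, PowerSeries.coe_substAlgHom,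
    formalInverse_subst_formalInverse] at h
  refine X_mul_cancel ?_
  linear_combination h - (mu F).subst (formalInverse F) * X_mul_mu F

end FormalInverse

section Normalization

variable {R : Type*} [CommRing R] (F : FormalGroup R) (ha : IsUnit (a₁₁ F))

/-- The formal inverse of `F̃` is the conjugate `h ∘ ι_F ∘ f` of that of `F`. -/
theorem formalInverse_normalization [F.IsComm] : formalInverse (normalization F ha) =
    (hSeries F).subst ((formalInverse F).subst (fSeries F ha) : PowerSeries R) := by
  have hX : (PowerSeries.X : PowerSeries R).constantCoeff = 0 := PowerSeries.constantCoeff_X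
  have hf := constantCoeff_fSeries F ha
  have hi := constantCoeff_formalInverse_subst F (σ := Unit) hf
  have hh := constantCoeff_hSeries_subst F (σ := Unit) hi
  have := eq_formalInverse_subst (normalization F ha) (σ := Unit) hX hh (by
    refine (normalizationSeries_subst F ha hX hh).trans ?_
    rw [fSeries_subst_hSeries_subst F ha hi, PowerSeries.X_subst,
      subst_self_formalInverse_subst F (σ := Unit) hf,
      PowerSeries.subst_zero_of_constantCoeff_zero (constantCoeff_hSeries F)])
  rw [PowerSeries.X_subst] at this
  exact this.symm

theorem mu_subst_fSeries : (mu F).subst (fSeries F ha) = 1 - (PowerSeries.X : PowerSeries R) := by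
  have hf := PowerSeries.HasSubst.of_constantCoeff_zero' (constantCoeff_fSeries F ha)
  have e : mu F = 1 - hSeries F := by rw [hSeries_eq]; ring
  rw [e, ← PowerSeries.coe_substAlgHom hf, map_sub, map_one, PowerSeries.coe_substAlgHom,
    hSeries_subst_fSeries]

/-- The formal inverse of the normalization is `ι(x) = x / (x - 1)`: substitute `f` into
`μ_F(x) μ_F(ι_F(x)) = 1`, using `μ_F = 1 - h`. -/
theorem one_sub_X_mul_one_sub_formalInverse_normalization [F.IsComm] :
    (1 - PowerSeries.X) * (1 - formalInverse (normalization F ha)) = 1 := by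
  have hf := PowerSeries.HasSubst.of_constantCoeff_zero' (constantCoeff_fSeries F ha)
  have hi := PowerSeries.HasSubst.of_constantCoeff_zero' (constantCoeff_formalInverse F)
  have h := congrArg (PowerSeries.substAlgHom hf) (mu_mul_mu_subst_formalInverse F)
  have e : mu F = 1 - hSeries F := by rw [hSeries_eq]; ring
  rw [map_mul, map_one, PowerSeries.coe_substAlgHom, mu_subst_fSeries,
    PowerSeries.subst_comp_subst_apply hi hf, e] at h
  have hif : PowerSeries.HasSubst ((formalInverse F).subst (fSeries F ha) : PowerSeries R) :=
    PowerSeries.HasSubst.of_constantCoeff_zero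
      (constantCoeff_formalInverse_subst F (σ := Unit) (constantCoeff_fSeries F ha))
  rw [← PowerSeries.coe_substAlgHom hif, map_sub, map_one, PowerSeries.coe_substAlgHom,
    ← formalInverse_normalization] at h
  exact h

theorem mu_normalization_mul [F.IsComm] : mu (normalization F ha) * (1 - PowerSeries.X) = 1 := by
  refine X_mul_cancel ?_
  linear_combination one_sub_X_mul_one_sub_formalInverse_normalization F ha -
    (1 - PowerSeries.X) * X_mul_mu (normalization F ha)

theorem mu_normalization [F.IsComm] :
    mu (normalization F ha) = 1 - formalInverse (normalization F ha) := by
  linear_combination (1 - formalInverse (normalization F ha)) * mu_normalization_mul F ha -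
    mu (normalization F ha) * one_sub_X_mul_one_sub_formalInverse_normalization F ha

theorem X_mul_kappa : PowerSeries.X * kappa F = 1 - PowerSeries.invOfUnit (mu F) 1 := by
  refine X_mul_divX ?_
  rw [map_sub, PowerSeries.constantCoeff_invOfUnit]
  simp

theorem mu_mul_invOfUnit : mu F * PowerSeries.invOfUnit (mu F) 1 = 1 :=
  PowerSeries.mul_invOfUnit _ _ (by rw [constantCoeff_mu]; rfl)

/-- For the normalized formal group law, `1/x + 1/ι(x) = 1`. -/
theorem kappa_normalization [F.IsComm] : kappa (normalization F ha) = 1 := by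
  refine X_mul_cancel ?_
  rw [X_mul_kappa]
  linear_combination (PowerSeries.X - 1) * mu_mul_invOfUnit (normalization F ha) +
    PowerSeries.invOfUnit (mu (normalization F ha)) 1 * mu_normalization_mul F ha

/-- The series `f(ι(x))`, where `ι` is the formal inverse of the normalization: the substitution
which underlies the isomorphism of formal affine Hecke algebras. -/
def twist : PowerSeries R := (fSeries F ha).subst (formalInverse (normalization F ha))

theorem constantCoeff_twist : (twist F ha).constantCoeff = 0 :=
  PowerSeries.constantCoeff_subst_eq_zero (constantCoeff_formalInverse _) _
    (constantCoeff_fSeries F ha)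

theorem mu_subst_twist [F.IsComm] : (mu F).subst (twist F ha) = mu (normalization F ha) := by
  have hf := PowerSeries.HasSubst.of_constantCoeff_zero' (constantCoeff_fSeries F ha)
  have hi := PowerSeries.HasSubst.of_constantCoeff_zero'
    (constantCoeff_formalInverse (normalization F ha))
  rw [twist, ← PowerSeries.subst_comp_subst_apply hf hi, mu_subst_fSeries,
    ← PowerSeries.coe_substAlgHom hi, map_sub, map_one, PowerSeries.substAlgHom_X,
    mu_normalization]

/-- Since `x κ^F(x) = 1 - 1/μ_F(x)`, replacing `x` by the twist gives `1 - (1 - x) = x`. -/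
theorem kappa_subst_twist_mul [F.IsComm] :
    (kappa F).subst (twist F ha) * twist F ha = PowerSeries.X := by
  have ht := PowerSeries.HasSubst.of_constantCoeff_zero' (constantCoeff_twist F ha)
  have h1 := congrArg (PowerSeries.substAlgHom ht) (X_mul_kappa F)
  have h2 := congrArg (PowerSeries.substAlgHom ht) (mu_mul_invOfUnit F)
  simp only [map_mul, map_sub, map_one, PowerSeries.substAlgHom_X] at h1 h2
  rw [PowerSeries.coe_substAlgHom] at h1 h2
  rw [mu_subst_twist] at h2
  linear_combination h1 +
    (PowerSeries.invOfUnit (mu F) 1).subst (twist F ha) * mu_normalization_mul F ha +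
    (PowerSeries.X - 1) * h2

theorem isUnit_divX {g : PowerSeries R} (h : IsUnit (g.coeff 1)) : IsUnit (divX g) := by
  rw [PowerSeries.isUnit_iff_constantCoeff, ← PowerSeries.coeff_zero_eq_constantCoeff_apply]
  simpa [divX] using h

theorem isUnit_coeff_one_fSeries : IsUnit ((fSeries F ha).coeff 1) := by
  rw [fSeries, PowerSeries.coeff_one_substInvOfIsUnit]
  exact Units.isUnit _

/-- `κ^F` has constant term `-a₁₁`, so inverting the `κ_α` changes nothing. -/
theorem isUnit_kappa (ha : IsUnit (a₁₁ F)) : IsUnit (kappa F) := by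
  have e : kappa F = -(PowerSeries.invOfUnit (mu F) 1 * divX (hSeries F)) := by
    refine X_mul_cancel ?_
    rw [X_mul_kappa]
    linear_combination PowerSeries.invOfUnit (mu F) 1 * X_mul_divX (constantCoeff_hSeries F) -
      mu_mul_invOfUnit F + PowerSeries.invOfUnit (mu F) 1 * hSeries_eq F
  rw [e]
  refine (IsUnit.mul ?_ (isUnit_divX (isUnit_coeff_one_hSeries F ha))).neg
  exact IsUnit.of_mul_eq_one_right _ (mu_mul_invOfUnit F)

end Normalization

/-! ### Localizations, twisted group algebras and generated subalgebras -/

section LocalizationMaps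

variable {W A B ι : Type*} [Group W] [CommRing A] [CommRing B] [MulSemiringAction W A]
  [MulSemiringAction W B]

theorem Loc.ringHom_ext {s : ι → A} {f g : Loc s →+* B}
    (h : ∀ u : A, f (algebraMap A (Loc s) u) = g (algebraMap A (Loc s) u)) : f = g :=
  IsLocalization.ringHom_ext (Submonoid.closure (Set.range s)) (RingHom.ext h)

/-- The extension to `A[1/s_i | i ∈ ι]` of a homomorphism under which the `s_i` are units. -/
def Loc.lift (s : ι → A) (f : A →+* B) (h : ∀ i, IsUnit (f (s i))) : Loc s →+* B :=
  IsLocalization.lift (M := Submonoid.closure (Set.range s)) (g := f) fun y => by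
    have hle : Submonoid.closure (Set.range s) ≤ (IsUnit.submonoid B).comap f := by
      rw [Submonoid.closure_le]
      rintro _ ⟨i, rfl⟩
      exact h i
    exact hle y.2

theorem Loc.lift_algebraMap (s : ι → A) (f : A →+* B) (h : ∀ i, IsUnit (f (s i))) (u : A) :
    Loc.lift s f h (algebraMap A (Loc s) u) = f u :=
  IsLocalization.lift_eq _ u

theorem Loc.isUnit_algebraMap (s : ι → A) (i : ι) : IsUnit (algebraMap A (Loc s) (s i)) :=
  IsUnit.of_mul_eq_one _ (Loc.algebraMap_mul_inv s i)

theorem Loc.isUnit_algebraMap_of_associated (t : ι → B) {b : B} {i : ι} (h : Associated b (t i)) :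
    IsUnit (algebraMap B (Loc t) b) :=
  (h.map (algebraMap B (Loc t))).isUnit_iff.2 (Loc.isUnit_algebraMap t i)

theorem associated_symm_apply {e : A ≃+* B} {a : A} {b : B} (h : Associated (e a) b) :
    Associated (e.symm b) a := by
  simpa using (h.map e.symm).symm

/-- The isomorphism `A[1/s_i] ≃ B[1/t_i]` extending an isomorphism `A ≃ B` which carries each `s_i`
to `t_i`, up to a unit. -/
def Loc.congr {s : ι → A} {t : ι → B} (e : A ≃+* B) (h : ∀ i, Associated (e (s i)) (t i)) :
    Loc s ≃+* Loc t :=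
  RingEquiv.ofRingHom
    (Loc.lift s ((algebraMap B (Loc t)).comp (e : A →+* B))
      fun i => Loc.isUnit_algebraMap_of_associated t (h i))
    (Loc.lift t ((algebraMap A (Loc s)).comp (e.symm : B →+* A))
      fun i => Loc.isUnit_algebraMap_of_associated s (associated_symm_apply (h i)))
    (Loc.ringHom_ext fun u => by simp [Loc.lift_algebraMap])
    (Loc.ringHom_ext fun u => by simp [Loc.lift_algebraMap])

theorem Loc.congr_algebraMap {s : ι → A} {t : ι → B} (e : A ≃+* B)
    (h : ∀ i, Associated (e (s i)) (t i)) (u : A) :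
    Loc.congr e h (algebraMap A (Loc s) u) = algebraMap B (Loc t) (e u) :=
  Loc.lift_algebraMap s ((algebraMap B (Loc t)).comp (e : A →+* B))
    (fun i => Loc.isUnit_algebraMap_of_associated t (h i)) u

theorem Loc.congr_inv {s : ι → A} {t : ι → B} (e : A ≃+* B)
    (h : ∀ i, Associated (e (s i)) (t i)) (i : ι) :
    ∃ u : Bˣ, Loc.congr e h (Loc.inv s i) = algebraMap B (Loc t) u * Loc.inv t i := by
  obtain ⟨u, hu⟩ := h i
  refine ⟨u, ?_⟩
  have h1 : Loc.congr e h (Loc.inv s i) * algebraMap B (Loc t) (e (s i)) = 1 := by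
    rw [← Loc.congr_algebraMap e h, ← map_mul, mul_comm, Loc.algebraMap_mul_inv, map_one]
  refine left_inv_eq_right_inv h1 ?_
  rw [← mul_assoc, ← map_mul, hu, Loc.algebraMap_mul_inv]

theorem Loc.congr_smul {s : ι → A} {t : ι → B} (hs : ∀ (w : W) (i : ι), ∃ j, w • s i = s j)
    (ht : ∀ (w : W) (i : ι), ∃ j, w • t i = t j) (e : A ≃+* B)
    (h : ∀ i, Associated (e (s i)) (t i)) (he : ∀ (w : W) (a : A), e (w • a) = w • e a) (w : W)
    (q : Loc s) :
    letI := Loc.action s hs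
    letI := Loc.action t ht
    Loc.congr e h (w • q) = w • Loc.congr e h q := by
  let := Loc.action s hs
  let := Loc.action t ht
  have : ((Loc.congr e h : Loc s →+* Loc t).comp (MulSemiringAction.toRingHom W (Loc s) w)) =
      (MulSemiringAction.toRingHom W (Loc t) w).comp (Loc.congr e h : Loc s →+* Loc t) := by
    refine Loc.ringHom_ext fun u => ?_
    simp only [RingHom.comp_apply, MulSemiringAction.toRingHom_apply, RingEquiv.coe_toRingHom]
    rw [Loc.action_algebraMap, Loc.congr_algebraMap, Loc.congr_algebraMap, Loc.action_algebraMap,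
      he]
  exact RingHom.congr_fun this q

end LocalizationMaps

section TwistedGroupAlgebra

variable {W A B : Type*} [Group W] [CommRing A] [CommRing B] [MulSemiringAction W A]
  [MulSemiringAction W B]

/-- The map `A ♯ W → B ♯ W`, `q δ_w ↦ f(q) δ_w`, for an equivariant homomorphism `f`. -/
def skewMap (f : A →+* B) (hf : ∀ (w : W) (a : A), f (w • a) = w • f a) :
    SkewMonoidAlgebra A W →+* SkewMonoidAlgebra B W :=
  SkewMonoidAlgebra.liftNCRingHom (SkewMonoidAlgebra.singleOneRingHom.comp f)
    (SkewMonoidAlgebra.of B W) fun {a w} => by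
      simp [SkewMonoidAlgebra.singleOneRingHom, SkewMonoidAlgebra.single_mul_single, hf]

theorem skewMap_single (f : A →+* B) (hf : ∀ (w : W) (a : A), f (w • a) = w • f a) (w : W)
    (a : A) : skewMap f hf (SkewMonoidAlgebra.single w a) = SkewMonoidAlgebra.single w (f a) := by
  refine (SkewMonoidAlgebra.liftNC_single _ _ _ _).trans ?_
  simp [SkewMonoidAlgebra.singleOneRingHom, SkewMonoidAlgebra.single_mul_single]

/-- The isomorphism `A ♯ W ≃ B ♯ W`, `q δ_w ↦ e(q) δ_w`, for an equivariant isomorphism `e`. -/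
def skewCongr (e : A ≃+* B) (he : ∀ (w : W) (a : A), e (w • a) = w • e a) :
    SkewMonoidAlgebra A W ≃+* SkewMonoidAlgebra B W :=
  have h (w : W) (a : A) : (e : A →+* B) (w • a) = w • (e : A →+* B) a := he w a
  have h' (w : W) (b : B) : (e.symm : B →+* A) (w • b) = w • (e.symm : B →+* A) b :=
    e.symm_apply_eq.2 ((congrArg _ (e.apply_symm_apply b).symm).trans (he w _).symm)
  RingEquiv.ofRingHom (skewMap (e : A →+* B) h) (skewMap (e.symm : B →+* A) h')
    (RingHom.coe_addMonoidHom_injective (SkewMonoidAlgebra.addHom_ext fun w b => by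
      change skewMap (e : A →+* B) h (skewMap (e.symm : B →+* A) h' _) =
        SkewMonoidAlgebra.single w b
      rw [skewMap_single, skewMap_single]
      simp))
    (RingHom.coe_addMonoidHom_injective (SkewMonoidAlgebra.addHom_ext fun w a => by
      change skewMap (e.symm : B →+* A) h' (skewMap (e : A →+* B) h _) =
        SkewMonoidAlgebra.single w a
      rw [skewMap_single, skewMap_single]
      simp))

theorem skewCongr_single (e : A ≃+* B) (he : ∀ (w : W) (a : A), e (w • a) = w • e a) (w : W)
    (a : A) : skewCongr e he (SkewMonoidAlgebra.single w a) = SkewMonoidAlgebra.single w (e a) :=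
  skewMap_single (e : A →+* B) he w a

theorem skewCongr_demazureElement (e : A ≃+* B) (he : ∀ (w : W) (a : A), e (w • a) = w • e a)
    (y : A) (s : W) :
    skewCongr e he (demazureElement y s) = demazureElement (e y) s := by
  rw [demazureElement, map_mul, map_sub, map_one, skewCongr_single, skewCongr_single, map_one]
  rfl

theorem single_one_mul_demazureElement (u y : A) (s : W) :
    SkewMonoidAlgebra.single 1 u * demazureElement y s = demazureElement (u * y) s := by
  rw [demazureElement, ← mul_assoc, SkewMonoidAlgebra.single_mul_single, one_mul, one_smul]
  rfl

end TwistedGroupAlgebra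

section Adjoin

variable {k k' X Y : Type*} [CommRing k] [CommRing k'] [Ring X] [Ring Y] [Algebra k X]
  [Algebra k' Y]

theorem map_mem_adjoin (s : k → k') (Φ : X →+* Y)
    (hΦ : ∀ r, Φ (algebraMap k X r) = algebraMap k' Y (s r)) {T : Set X} {T' : Set Y}
    (h : ∀ x ∈ T, Φ x ∈ Algebra.adjoin k' T') {x : X} (hx : x ∈ Algebra.adjoin k T) :
    Φ x ∈ Algebra.adjoin k' T' := by
  induction hx using Algebra.adjoin_induction with
  | mem x hx => exact h x hx
  | algebraMap r => exact hΦ r ▸ Subalgebra.algebraMap_mem _ _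
  | add x y _ _ hx hy => exact (map_add Φ x y).symm ▸ add_mem hx hy
  | mul x y _ _ hx hy => exact (map_mul Φ x y).symm ▸ mul_mem hx hy

/-- A semilinear ring isomorphism which matches generators of two subalgebras restricts to a ring
isomorphism between them. -/
theorem exists_adjoin_ringEquiv (s : k ≃+* k') (Φ : X ≃+* Y)
    (hΦ : ∀ r, Φ (algebraMap k X r) = algebraMap k' Y (s r)) {T : Set X} {T' : Set Y}
    (h : ∀ x ∈ T, Φ x ∈ Algebra.adjoin k' T')
    (h' : ∀ y ∈ T', ∃ x ∈ Algebra.adjoin k T, Φ x = y) :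
    ∃ ΦD : Algebra.adjoin k T ≃+* Algebra.adjoin k' T', ∀ d, (ΦD d : Y) = Φ d := by
  have h1 {x : X} (hx : x ∈ Algebra.adjoin k T) : Φ x ∈ Algebra.adjoin k' T' :=
    map_mem_adjoin s (Φ : X →+* Y) hΦ h hx
  have h2 {y : Y} (hy : y ∈ Algebra.adjoin k' T') : Φ.symm y ∈ Algebra.adjoin k T := by
    refine map_mem_adjoin s.symm (Φ.symm : Y →+* X) (fun r => ?_) (fun y hy => ?_) hy
    · rw [RingEquiv.coe_toRingHom, RingEquiv.symm_apply_eq, hΦ, RingEquiv.apply_symm_apply]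
    · obtain ⟨x, hx, rfl⟩ := h' y hy
      rwa [RingEquiv.coe_toRingHom, RingEquiv.symm_apply_apply]
  exact ⟨{  toFun := fun d => ⟨Φ d, h1 d.2⟩
            invFun := fun d => ⟨Φ.symm d, h2 d.2⟩
            left_inv := fun d => Subtype.ext (Φ.symm_apply_apply _)
            right_inv := fun d => Subtype.ext (Φ.apply_symm_apply _)
            map_mul' := fun x y => Subtype.ext (map_mul Φ _ _)
            map_add' := fun x y => Subtype.ext (map_add Φ _ _) }, fun _ => rfl⟩

end Adjoin

/-! ### Isomorphisms of formal group algebras -/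

section FormalGroupHoms

variable {R S : Type*} [CommRing R] [CommRing S]

/-- `g` is a homomorphism of formal group laws from `G` to `F`: it has no constant term, and
`F(g(x), g(y)) = g(G(x, y))`. -/
structure IsFormalHom (G F : FormalGroup R) (g : PowerSeries R) : Prop where
  constantCoeff_eq_zero : g.constantCoeff = 0
  subst_eq : F.toPowerSeries.subst
    ![(g.subst (MvPowerSeries.X 0 : MvPowerSeries (Fin 2) R) : MvPowerSeries (Fin 2) R),
      g.subst (MvPowerSeries.X 1 : MvPowerSeries (Fin 2) R)] = g.subst G.toPowerSeries

theorem constantCoeff_powerSeries_map {g : PowerSeries R} (hg : g.constantCoeff = 0) (s : R →+* S) :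
    (PowerSeries.map s g).constantCoeff = 0 := by
  rw [← PowerSeries.coeff_zero_eq_constantCoeff_apply, PowerSeries.coeff_map,
    PowerSeries.coeff_zero_eq_constantCoeff_apply, hg, map_zero]

theorem powerSeries_map_subst {τ : Type*} {a : MvPowerSeries τ R} (ha : a.constantCoeff = 0)
    (s : R →+* S) (g : PowerSeries R) :
    MvPowerSeries.map s (g.subst a) = (PowerSeries.map s g).subst (MvPowerSeries.map s a) :=
  PowerSeries.map_subst (PowerSeries.HasSubst.of_constantCoeff_zero ha) g

theorem IsFormalHom.map {G F : FormalGroup R} {g : PowerSeries R} (h : IsFormalHom G F g)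
    (s : R →+* S) : IsFormalHom (G.map s) (F.map s) (PowerSeries.map s g) where
  constantCoeff_eq_zero := constantCoeff_powerSeries_map h.constantCoeff_eq_zero s
  subst_eq := by
    have h0 := constantCoeff_subst_X (τ := Fin 2) g h.constantCoeff_eq_zero
    have key (i : Fin 2) : ((PowerSeries.map s g).subst (MvPowerSeries.X i) :
        MvPowerSeries (Fin 2) S) = MvPowerSeries.map s (g.subst (MvPowerSeries.X i)) := by
      rw [powerSeries_map_subst (MvPowerSeries.constantCoeff_X _), MvPowerSeries.map_X]
    have e := congrArg (MvPowerSeries.map s) h.subst_eq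
    rw [powerSeries_map_subst G.zero_constantCoeff,
      MvPowerSeries.map_subst (hasSubst_pair (h0 0) (h0 1))] at e
    rw [FormalGroup.map_toPowerSeries, FormalGroup.map_toPowerSeries, ← e]
    congr 1
    funext i
    fin_cases i
    · exact key 0
    · exact key 1

variable (F : FormalGroup R) (ha : IsUnit (a₁₁ F))

theorem isFormalHom_fSeries : IsFormalHom (normalization F ha) F (fSeries F ha) where
  constantCoeff_eq_zero := constantCoeff_fSeries F ha
  subst_eq := by
    have h (i : Fin 2) : (MvPowerSeries.X i : MvPowerSeries (Fin 2) R).constantCoeff = 0 :=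
      MvPowerSeries.constantCoeff_X i
    refine Eq.symm (fSeries_subst_hSeries_subst F ha (constantCoeff_subst_pair F
      (constantCoeff_fSeries_subst F ha (h 0)) (constantCoeff_fSeries_subst F ha (h 1))))

theorem isFormalHom_hSeries : IsFormalHom F (normalization F ha) (hSeries F) where
  constantCoeff_eq_zero := constantCoeff_hSeries F
  subst_eq := by
    have h (i : Fin 2) : (MvPowerSeries.X i : MvPowerSeries (Fin 2) R).constantCoeff = 0 :=
      MvPowerSeries.constantCoeff_X i
    refine (normalizationSeries_subst F ha (constantCoeff_hSeries_subst F (h 0))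
      (constantCoeff_hSeries_subst F (h 1))).trans ?_
    rw [fSeries_subst_hSeries_subst F ha (h 0), fSeries_subst_hSeries_subst F ha (h 1)]
    congr 1
    have e : ![(MvPowerSeries.X 0 : MvPowerSeries (Fin 2) R), MvPowerSeries.X 1] =
        MvPowerSeries.X := by
      funext i; fin_cases i <;> rfl
    rw [e, MvPowerSeries.subst_self, id]

theorem isFormalHom_formalInverse [F.IsComm] : IsFormalHom F F (formalInverse F) where
  constantCoeff_eq_zero := constantCoeff_formalInverse F
  subst_eq := by
    rw [subst_formalInverse_pair F (MvPowerSeries.constantCoeff_X _)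
      (MvPowerSeries.constantCoeff_X _)]
    congr 1
    have e : ![(MvPowerSeries.X 0 : MvPowerSeries (Fin 2) R), MvPowerSeries.X 1] =
        MvPowerSeries.X := by
      funext i; fin_cases i <;> rfl
    rw [e, MvPowerSeries.subst_self, id]

theorem formalGroup_map_map {T : Type*} [CommRing T] (s : R →+* S) (t : S →+* T) :
    (F.map s).map t = F.map (t.comp s) := by
  ext : 1
  rfl

theorem formalGroup_map_id : F.map (RingHom.id R) = F := by
  ext : 1
  rw [FormalGroup.map_toPowerSeries, MvPowerSeries.map_id]
  rfl

end FormalGroupHoms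

section Isomorphisms

variable {R S Λ : Type*} [CommRing R] [CommRing S] [AddCommGroup Λ]

variable (Λ) in
/-- Mutually inverse homomorphisms of formal group laws induce mutually inverse substitutions. -/
theorem exists_isSubstitution (F : FormalGroup R) (G : FormalGroup S) (s : R ≃+* S)
    {g : PowerSeries S} {g' : PowerSeries R}
    (hg : IsFormalHom G (F.map (s : R →+* S)) g)
    (hg' : IsFormalHom F (G.map (s.symm : S →+* R)) g')
    (h : (PowerSeries.map (s.symm : S →+* R) g).subst g' = (PowerSeries.X : PowerSeries R))
    (h' : (PowerSeries.map (s : R →+* S) g').subst g = (PowerSeries.X : PowerSeries S)) :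
    ∃ φ : FGA F Λ ≃+* FGA G Λ, IsSubstitution s g φ := by
  obtain ⟨φ, hφ⟩ := exists_isSubstitutionHom (Λ := Λ) F G (s : R →+* S) g
    hg.constantCoeff_eq_zero hg.subst_eq
  obtain ⟨ψ, hψ⟩ := exists_isSubstitutionHom (Λ := Λ) G F (s.symm : S →+* R) g'
    hg'.constantCoeff_eq_zero hg'.subst_eq
  have h1 : ψ.comp φ = RingHom.id _ := by
    have e := hψ.comp hg'.constantCoeff_eq_zero hφ
    have hs : (s.symm : S →+* R).comp (s : R →+* S) = RingHom.id R :=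
      RingHom.ext s.symm_apply_apply
    rw [h, hs] at e
    exact e.eq_id
  have h2 : φ.comp ψ = RingHom.id _ := by
    have e := hφ.comp hg.constantCoeff_eq_zero hψ
    have hs : (s : R →+* S).comp (s.symm : S →+* R) = RingHom.id S :=
      RingHom.ext s.apply_symm_apply
    rw [h', hs] at e
    exact e.eq_id
  refine ⟨RingEquiv.ofRingHom φ ψ h2 h1, hφ.map_algebraMap, hφ.map_x, fun n u =>
    ⟨fun hu => ?_, hφ.map_mem_fil n u⟩⟩
  have e : ψ (φ u) = u := RingHom.congr_fun h1 u
  exact e ▸ hψ.map_mem_fil n _ hu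

theorem IsSubstitution.isSubstitutionHom {F : FormalGroup R} {G : FormalGroup S} {s : R ≃+* S}
    {g : PowerSeries S} {φ : FGA F Λ ≃+* FGA G Λ} (h : IsSubstitution s g φ) :
    IsSubstitutionHom (s : R →+* S) g (φ : FGA F Λ →+* FGA G Λ) :=
  ⟨h.map_algebraMap, h.map_x, fun n u hu => (h.mem_fil n u).2 hu⟩

theorem powerSeries_map_id (g : PowerSeries R) : PowerSeries.map (RingHom.id R) g = g := by
  rw [PowerSeries.map_id, id]

variable (Λ) in
theorem exists_isSubstitution_refl {F G : FormalGroup R} {g g' : PowerSeries R}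
    (hg : IsFormalHom G F g) (hg' : IsFormalHom F G g')
    (h : g.subst g' = (PowerSeries.X : PowerSeries R))
    (h' : g'.subst g = (PowerSeries.X : PowerSeries R)) :
    ∃ φ : FGA F Λ ≃+* FGA G Λ, IsSubstitution (RingEquiv.refl R) g φ := by
  have e : ((RingEquiv.refl R : R ≃+* R) : R →+* R) = RingHom.id R := rfl
  have e' : ((RingEquiv.refl R : R ≃+* R).symm : R →+* R) = RingHom.id R := rfl
  refine exists_isSubstitution Λ F G (RingEquiv.refl R) (g' := g') ?_ ?_ ?_ ?_
  · rwa [e, formalGroup_map_id]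
  · rwa [e', formalGroup_map_id]
  · rwa [e', powerSeries_map_id]
  · rwa [e, powerSeries_map_id]

variable (Λ) in
/-- Isomorphic formal group laws over `R` have isomorphic formal group algebras over the coefficient
rings `R_F` and `R_G`, compatibly with a given `R`-linear isomorphism of the latter. -/
theorem exists_isSubstitution_baseChange {F G : FormalGroup R} {g g' : PowerSeries R}
    (hg : IsFormalHom G F g) (hg' : IsFormalHom F G g')
    (h : g.subst g' = (PowerSeries.X : PowerSeries R))
    (h' : g'.subst g = (PowerSeries.X : PowerSeries R)) {Γ : Type*} [AddCommGroup Γ]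
    (s : FGA F Γ ≃+* FGA G Γ)
    (hs : ∀ r : R, s (algebraMap R (FGA F Γ) r) = algebraMap R (FGA G Γ) r) :
    ∃ φ : FGA₂ F Γ Λ ≃+* FGA₂ G Γ Λ,
      IsSubstitution s (PowerSeries.map (algebraMap R (FGA G Γ)) g) φ := by
  have e : (s : FGA F Γ →+* FGA G Γ).comp (algebraMap R (FGA F Γ)) = algebraMap R (FGA G Γ) :=
    RingHom.ext hs
  have e' : (s.symm : FGA G Γ →+* FGA F Γ).comp (algebraMap R (FGA G Γ)) =
      algebraMap R (FGA F Γ) := RingHom.ext fun r => by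
    rw [RingHom.comp_apply, RingEquiv.coe_toRingHom, RingEquiv.symm_apply_eq, hs]
  have hmap {k k' : PowerSeries R} (hk' : k'.constantCoeff = 0)
      (hk : k.subst k' = (PowerSeries.X : PowerSeries R)) (T : Type _) [CommRing T]
      (t : R →+* T) : (PowerSeries.map t k).subst (PowerSeries.map t k') =
        (PowerSeries.X : PowerSeries T) := by
    refine (powerSeries_map_subst (τ := Unit) hk' t k).symm.trans ?_
    rw [hk]
    exact PowerSeries.map_X t
  refine exists_isSubstitution Λ (baseChange F Γ) (baseChange G Γ) s
    (g' := PowerSeries.map (algebraMap R (FGA F Γ)) g') ?_ ?_ ?_ ?_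
  · rw [baseChange, formalGroup_map_map, e]
    exact hg.map _
  · rw [baseChange, baseChange, formalGroup_map_map, e']
    exact hg'.map _
  · rw [← RingHom.comp_apply, ← PowerSeries.map_comp, e']
    exact hmap hg'.constantCoeff_eq_zero h _ _
  · rw [← RingHom.comp_apply, ← PowerSeries.map_comp, e]
    exact hmap hg.constantCoeff_eq_zero h' _ _

variable {F : FormalGroup R} {G : FormalGroup S}

theorem FGA.map_mem_fil {Λ' : Type*} [AddCommGroup Λ'] (v : Λ →+ Λ') (n : ℕ) {u : FGA F Λ}
    (hu : u ∈ FGA.fil F n) : FGA.map F v u ∈ FGA.fil F n := by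
  obtain ⟨z, hz, rfl⟩ := (Ideal.mem_map_iff_of_surjective _ (FGA.mk_surjective F)).1 hu
  rw [FGA.map_mk]
  refine Ideal.mem_map_of_mem _ ?_
  obtain ⟨t, rfl⟩ := AdicCompletion.mk_surjective _ _ z
  rw [RingHom.mem_ker, AdicCompletion.evalₐ_mk, Ideal.Quotient.eq_zero_iff_mem] at hz
  rw [RingHom.mem_ker, CPoly.evalₐ_map_mk, Ideal.Quotient.eq_zero_iff_mem]
  exact idealOfVars_pow_le_comap_rename v n hz

section WeylGroupAction

variable {ι Λ' : Type*} [AddCommGroup Λ'] (P : RootDatum ι Λ Λ')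

theorem FGA.smul_mem_fil (w : P.weylGroup) (n : ℕ) {u : FGA F Λ} (hu : u ∈ FGA.fil F n) :
    w • u ∈ FGA.fil F n :=
  FGA.map_mem_fil (DistribSMul.toAddMonoidHom Λ w) n hu

/-- Substitutions commute with the Weyl group, as both sides agree on coefficients and on
the `x_λ`. -/
theorem IsSubstitutionHom.map_smul {s : R →+* S} {g : PowerSeries S} {φ : FGA F Λ →+* FGA G Λ}
    (h : IsSubstitutionHom s g φ) (w : P.weylGroup) (u : FGA F Λ) : φ (w • u) = w • φ u := by
  have : φ.comp (MulSemiringAction.toRingHom P.weylGroup (FGA F Λ) w) =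
      (MulSemiringAction.toRingHom P.weylGroup (FGA G Λ) w).comp φ := by
    refine FGA.ringHom_ext (fun n u hu => h.map_mem_fil n (w • u) (FGA.smul_mem_fil P w n hu))
      (fun n u hu => FGA.smul_mem_fil P w n (h.map_mem_fil n u hu)) (fun r => ?_) fun l => ?_
    · change φ (w • algebraMap R (FGA F Λ) r) = w • φ (algebraMap R (FGA F Λ) r)
      rw [smul_algebraMap, h.map_algebraMap, smul_algebraMap]
    · change φ (w • FGA.x F l) = w • φ (FGA.x F l)
      rw [FGA.smul_x, h.map_x, h.map_x, FGA.smul_eval]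
  exact RingHom.congr_fun this u

end WeylGroupAction

theorem FGA.eval_mul (k k' : PowerSeries R) (l : Λ) :
    FGA.eval F (k * k') l = FGA.eval F k l * FGA.eval F k' l :=
  map_mul (FGA.subst F (fun _ : Unit => l)) k k'

theorem FGA.eval_one (l : Λ) : FGA.eval F 1 l = 1 :=
  map_one (FGA.subst F (fun _ : Unit => l))

theorem FGA.isUnit_eval {k : PowerSeries R} (hk : IsUnit k) (l : Λ) : IsUnit (FGA.eval F k l) :=
  IsUnit.map (FGA.subst F (fun _ : Unit => l)) hk

theorem FGA.associated_eval {k : PowerSeries R} (hk : Associated k PowerSeries.X) (l : Λ) :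
    Associated (FGA.eval F k l) (FGA.x F l) :=
  FGA.eval_X (F := F) l ▸ Associated.map (FGA.subst F (fun _ : Unit => l)) hk

theorem associated_X {g : PowerSeries R} (hg : g.constantCoeff = 0) (h : IsUnit (g.coeff 1)) :
    Associated g PowerSeries.X := by
  obtain ⟨u, hu⟩ := isUnit_divX h
  exact Associated.symm ⟨u, by rw [hu, X_mul_divX hg]⟩

end Isomorphisms

/-! ### Demazure and Hecke algebras -/

section Algebras

variable {R : Type*} [CommRing R] {ι Λ Λ' : Type*} [AddCommGroup Λ] [AddCommGroup Λ']
  {F G : FormalGroup R} (P : RootDatum ι Λ Λ')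

section Demazure

/-- A substitution `x_λ ↦ g(x_λ)` with `g(x) = x ⬝ unit` extends to the twisted formal group
algebras, and the extension identifies the formal affine Demazure algebras. -/
theorem exists_demazure_ringEquiv {g : PowerSeries R} (hg : Associated g PowerSeries.X)
    {φ : FGA F Λ ≃+* FGA G Λ} (hφ : IsSubstitution (RingEquiv.refl R) g φ) :
    ∃ Φ : QW F P ≃+* QW G P,
      (∀ (w : P.weylGroup) (u : FGA F Λ),
        Φ (SkewMonoidAlgebra.single w (algebraMap (FGA F Λ) (Q F P) u)) =
          SkewMonoidAlgebra.single w (algebraMap _ (Q G P) (φ u))) ∧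
      ∃ ΦD : D F P ≃+* D G P, ∀ d : D F P, (ΦD d : QW G P) = Φ d := by
  have hA (i : ι) : Associated (φ (xRoot F P i)) (xRoot G P i) := by
    rw [xRoot, hφ.map_x]
    exact FGA.associated_eval hg _
  let E : Q F P ≃+* Q G P := Loc.congr φ hA
  have hE (u : FGA F Λ) : E (algebraMap _ (Q F P) u) = algebraMap _ (Q G P) (φ u) :=
    Loc.congr_algebraMap φ hA u
  have hEsmul (w : P.weylGroup) (q : Q F P) : E (w • q) = w • E q :=
    Loc.congr_smul (smul_xRoot F P) (smul_xRoot G P) φ hA (hφ.isSubstitutionHom.map_smul P) w q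
  let Φ : QW F P ≃+* QW G P := skewCongr E hEsmul
  have hΦ (w : P.weylGroup) (u : FGA F Λ) :
      Φ (SkewMonoidAlgebra.single w (algebraMap (FGA F Λ) (Q F P) u)) =
        SkewMonoidAlgebra.single w (algebraMap _ (Q G P) (φ u)) :=
    (skewCongr_single E hEsmul w _).trans (congrArg _ (hE u))
  have hX (i : ι) : ∃ u : (FGA G Λ)ˣ,
      Φ (X F P i) = SkewMonoidAlgebra.single 1 (algebraMap (FGA G Λ) (Q G P) u) * X G P i := by
    obtain ⟨u, hu⟩ := Loc.congr_inv φ hA i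
    refine ⟨u, ?_⟩
    rw [X, X, single_one_mul_demazureElement]
    exact (skewCongr_demazureElement E hEsmul _ _).trans
      (congrArg (fun q => demazureElement q _) hu)
  refine ⟨Φ, hΦ, exists_adjoin_ringEquiv (RingEquiv.refl R) Φ (fun r => ?_) ?_ ?_⟩
  · rw [SkewMonoidAlgebra.coe_algebraMap, SkewMonoidAlgebra.coe_algebraMap, Function.comp_apply,
      Function.comp_apply, IsScalarTower.algebraMap_apply R (FGA F Λ) (Q F P), hΦ,
      hφ.map_algebraMap, ← IsScalarTower.algebraMap_apply]
  · rintro _ (⟨u, rfl⟩ | ⟨i, rfl⟩)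
    · exact Algebra.subset_adjoin (Or.inl ⟨φ u, (hΦ 1 u).symm⟩)
    · obtain ⟨u, hu⟩ := hX i
      rw [hu]
      exact mul_mem (Algebra.subset_adjoin (Or.inl ⟨u, rfl⟩))
        (Algebra.subset_adjoin (Or.inr ⟨i, rfl⟩))
  · rintro _ (⟨u, rfl⟩ | ⟨i, rfl⟩)
    · exact ⟨_, Algebra.subset_adjoin (Or.inl ⟨φ.symm u, rfl⟩), by
        rw [hΦ, RingEquiv.apply_symm_apply]⟩
    · obtain ⟨u, hu⟩ := hX i
      refine ⟨_, mul_mem (Algebra.subset_adjoin (Or.inl ⟨φ.symm ↑u⁻¹, rfl⟩))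
        (Algebra.subset_adjoin (Or.inr ⟨i, rfl⟩)), ?_⟩
      rw [map_mul, hΦ, hu, RingEquiv.apply_symm_apply, ← mul_assoc,
        SkewMonoidAlgebra.single_mul_single, one_smul, one_mul, ← map_mul, Units.inv_mul, map_one]
      exact one_mul _

end Demazure

section Hecke

variable {Γ : Type*} [AddCommGroup Γ]

theorem isUnit_kappaRoot' (hF : IsUnit (kappa F)) (i : ι) : IsUnit (kappaRoot' Γ F P i) := by
  rw [kappaRoot']
  split_ifs
  · exact isUnit_one
  · exact FGA.isUnit_eval (hF.map _) _

theorem Loc.inv_eq_one {A : Type*} [CommRing A] {s : ι → A} {i : ι} (h : s i = 1) :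
    Loc.inv s i = 1 := by
  have := Loc.algebraMap_mul_inv s i
  rwa [h, map_one, one_mul] at this

theorem T_eq (hF : kappa F ≠ 0) (γ : Γ) (i : ι) :
    T F P γ i = demazureElement (algebraMap (FGAκ Γ F P) (Q' Γ F P)
        (algebraMap (FGA F Γ) (FGAκ Γ F P) (Theta F γ) * Loc.inv (kappaRoot' Γ F P) i) *
          Loc.inv (xRootκ Γ F P) i) (RootPairing.weylGroup.ofIdx P i) +
      SkewMonoidAlgebra.single (RootPairing.weylGroup.ofIdx P i)
        (algebraMap (FGA F Γ) (Q' Γ F P) (FGA.eval F (mu F) γ)) := by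
  rw [T, vartheta, varpi, if_neg hF, if_neg hF, single_one_mul_demazureElement]

/-- If the substitution `x_λ ↦ t(x_λ)` carries `μ_F` to `μ_G` and `x κ^F` to `x`, and if `κ^G = 1`,
then it extends to the twisted formal group algebras, the extension carries `T_α` to `T_α`, and it
identifies the formal affine Hecke algebras. -/
theorem exists_hecke_ringEquiv (b : P.Base) (γ : Γ) {t : PowerSeries R}
    (ht : t.constantCoeff = 0) (hF : IsUnit (kappa F)) (hG : kappa G = 1)
    (hμ : (mu F).subst t = mu G) (hκ : (kappa F).subst t * t = PowerSeries.X)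
    (eΓ : FGA F Γ ≃+* FGA G Γ) (heΓ : IsSubstitutionHom (RingHom.id R) t (eΓ : FGA F Γ →+* FGA G Γ))
    (e : FGA₂ F Γ Λ ≃+* FGA₂ G Γ Λ)
    (he : IsSubstitutionHom (eΓ : FGA F Γ →+* FGA G Γ)
      (PowerSeries.map (algebraMap R (FGA G Γ)) t) (e : FGA₂ F Γ Λ →+* FGA₂ G Γ Λ)) :
    ∃ Ψ : QW' Γ F P ≃+* QW' Γ G P,
      (∀ (w : P.weylGroup) (u : FGA₂ F Γ Λ),
        Ψ (SkewMonoidAlgebra.single w (algebraMap (FGA₂ F Γ Λ) (Q' Γ F P) u)) =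
          SkewMonoidAlgebra.single w (algebraMap _ (Q' Γ G P) (e u))) ∧
      (∃ ΨH : H F P b γ ≃+* H G P b γ, ∀ d : H F P b γ, (ΨH d : QW' Γ G P) = Ψ d) ∧
      ∀ i, Ψ (T F P γ i) = T G P γ i := by
  have hts := PowerSeries.HasSubst.of_constantCoeff_zero' ht
  have htX : Associated t PowerSeries.X := by
    have h := hF.map (PowerSeries.substAlgHom hts)
    rw [PowerSeries.coe_substAlgHom] at h
    exact ⟨h.unit, by rw [mul_comm]; exact hκ⟩
  have hκ1 (i : ι) : Associated (e (kappaRoot' Γ F P i)) (kappaRoot' Γ G P i) :=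
    (associated_one_iff_isUnit.2 ((isUnit_kappaRoot' P hF i).map e)).trans
      (associated_one_iff_isUnit.2 (isUnit_kappaRoot' P (hG ▸ isUnit_one) i)).symm
  have hx (i : ι) : e (xRoot (baseChange F Γ) P i) = FGA.eval (baseChange G Γ)
      (PowerSeries.map (algebraMap R (FGA G Γ)) t) (P.root i) := he.map_x _
  let E₁ : FGAκ Γ F P ≃+* FGAκ Γ G P := Loc.congr e hκ1
  have hE₁ (u : FGA₂ F Γ Λ) : E₁ (algebraMap _ (FGAκ Γ F P) u) = algebraMap _ (FGAκ Γ G P) (e u) :=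
    Loc.congr_algebraMap e hκ1 u
  have hE₁smul (w : P.weylGroup) (q : FGAκ Γ F P) : E₁ (w • q) = w • E₁ q :=
    Loc.congr_smul (smul_kappaRoot' F P) (smul_kappaRoot' G P) e hκ1 (he.map_smul P) w q
  have hx1 (i : ι) : Associated (E₁ (xRootκ Γ F P i)) (xRootκ Γ G P i) := by
    rw [xRootκ, hE₁, hx]
    refine Associated.map (algebraMap (FGA₂ G Γ Λ) (FGAκ Γ G P)) (FGA.associated_eval ?_ _)
    have := htX.map (PowerSeries.map (algebraMap R (FGA G Γ)))
    rwa [PowerSeries.map_X] at this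
  let E : Q' Γ F P ≃+* Q' Γ G P := Loc.congr E₁ hx1
  have hE (u : FGAκ Γ F P) : E (algebraMap _ (Q' Γ F P) u) = algebraMap _ (Q' Γ G P) (E₁ u) :=
    Loc.congr_algebraMap E₁ hx1 u
  have hEsmul (w : P.weylGroup) (q : Q' Γ F P) : E (w • q) = w • E q :=
    Loc.congr_smul (smul_xRootκ F P) (smul_xRootκ G P) E₁ hx1 hE₁smul w q
  have hE₁c (r : FGA F Γ) :
      E₁ (algebraMap (FGA F Γ) (FGAκ Γ F P) r) = algebraMap (FGA G Γ) (FGAκ Γ G P) (eΓ r) := by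
    rw [IsScalarTower.algebraMap_apply (FGA F Γ) (FGA₂ F Γ Λ) (FGAκ Γ F P), hE₁,
      IsScalarTower.algebraMap_apply (FGA G Γ) (FGA₂ G Γ Λ) (FGAκ Γ G P)]
    exact congrArg _ (he.map_algebraMap r)
  have hEc (r : FGA F Γ) :
      E (algebraMap (FGA F Γ) (Q' Γ F P) r) = algebraMap (FGA G Γ) (Q' Γ G P) (eΓ r) := by
    rw [IsScalarTower.algebraMap_apply (FGA F Γ) (FGAκ Γ F P) (Q' Γ F P), hE, hE₁c,
      ← IsScalarTower.algebraMap_apply]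
  let Ψ : QW' Γ F P ≃+* QW' Γ G P := skewCongr E hEsmul
  have hΨ (w : P.weylGroup) (q : Q' Γ F P) :
      Ψ (SkewMonoidAlgebra.single w q) = SkewMonoidAlgebra.single w (E q) :=
    skewCongr_single E hEsmul w q
  have hmu (l : Γ) : eΓ (FGA.eval F (mu F) l) = FGA.eval G (mu G) l := by
    have := heΓ.map_eval ht (mu F) l
    rwa [PowerSeries.map_id, id, hμ] at this
  have hTheta : eΓ (Theta F γ) = Theta G γ := by
    rw [Theta, map_sub, hmu, hmu, Theta]
  have hT (i : ι) : Ψ (T F P γ i) = T G P γ i := by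
    -- Over the zero ring `κ^F = 0`, and `T_α` is defined by the other case; but all is zero then.
    rcases subsingleton_or_nontrivial R with hR | hR
    · have := (algebraMap R (FGA G Γ)).codomain_trivial
      have := Module.subsingleton (FGA G Γ) (QW' Γ G P)
      exact Subsingleton.elim _ _
    have hF0 : kappa F ≠ 0 := hF.ne_zero
    have hG0 : kappa G ≠ 0 := hG ▸ one_ne_zero
    -- The image of `1 / (κ_α x_α)` is `1 / x_α`, because the image of `κ_α x_α` is `x_α`.
    have hinv : E (algebraMap _ (Q' Γ F P) (Loc.inv (kappaRoot' Γ F P) i)) *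
        E (Loc.inv (xRootκ Γ F P) i) = Loc.inv (xRootκ Γ G P) i := by
      have h1 := congrArg (fun q => E (algebraMap _ (Q' Γ F P) q))
        (Loc.algebraMap_mul_inv (kappaRoot' Γ F P) i)
      have h2 := congrArg E (Loc.algebraMap_mul_inv (xRootκ Γ F P) i)
      have h3 : e (kappaRoot' Γ F P i) * e (xRoot (baseChange F Γ) P i) =
          xRoot (baseChange G Γ) P i := by
        have hc := constantCoeff_powerSeries_map ht (algebraMap R (FGA G Γ))
        have hm : PowerSeries.map (eΓ : FGA F Γ →+* FGA G Γ)
            (PowerSeries.map (algebraMap R (FGA F Γ)) (kappa F)) =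
              PowerSeries.map (algebraMap R (FGA G Γ)) (kappa F) := by
          rw [← RingHom.comp_apply, ← PowerSeries.map_comp]
          congr 2
          exact RingHom.ext heΓ.map_algebraMap
        have hk : e (kappaRoot Γ F P i) = FGA.eval (baseChange G Γ)
            (PowerSeries.map (algebraMap R (FGA G Γ)) ((kappa F).subst t)) (P.root i) := by
          refine (he.map_eval hc _ _).trans ?_
          rw [hm]
          exact congrArg (fun k => FGA.eval (baseChange G Γ) k (P.root i))
            (powerSeries_map_subst (τ := Unit) ht _ _).symm
        rw [hx, kappaRoot', if_neg hF0, hk, ← FGA.eval_mul, ← map_mul, hκ, PowerSeries.map_X,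
          FGA.eval_X]
      have h4 := Loc.algebraMap_mul_inv (xRootκ Γ G P) i
      simp only [map_mul, map_one] at h1 h2
      rw [hE, hE₁] at h1 h2
      refine left_inv_eq_right_inv ?_ h4
      rw [xRootκ, ← h3, map_mul, map_mul]
      have h5 := congrArg₂ HMul.hMul h1 h2
      linear_combination h5
    rw [T_eq P hF0, T_eq P hG0, map_add, hΨ, hEc, hmu]
    congr 1
    refine (skewCongr_demazureElement E hEsmul _ _).trans ?_
    have hk : kappaRoot' Γ G P i = 1 := by
      rw [kappaRoot', if_neg hG0, kappaRoot, hG, map_one, FGA.eval_one]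
    rw [map_mul, map_mul, map_mul, mul_assoc, hinv, hE, hE₁c, hTheta, Loc.inv_eq_one hk, mul_one]
  refine ⟨Ψ, fun w u => ?_, exists_adjoin_ringEquiv eΓ Ψ (fun r => ?_) ?_ ?_, hT⟩
  · rw [hΨ, IsScalarTower.algebraMap_apply (FGA₂ F Γ Λ) (FGAκ Γ F P) (Q' Γ F P), hE, hE₁,
      ← IsScalarTower.algebraMap_apply]
  · rw [SkewMonoidAlgebra.coe_algebraMap, SkewMonoidAlgebra.coe_algebraMap, Function.comp_apply,
      Function.comp_apply, hΨ, hEc]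
  · rintro _ (⟨u, rfl⟩ | ⟨i, hi, rfl⟩)
    · exact Algebra.subset_adjoin (Or.inl ⟨E₁ u, by rw [hΨ, hE]⟩)
    · exact Algebra.subset_adjoin (Or.inr ⟨i, hi, (hT i).symm⟩)
  · rintro _ (⟨u, rfl⟩ | ⟨i, hi, rfl⟩)
    · exact ⟨_, Algebra.subset_adjoin (Or.inl ⟨E₁.symm u, rfl⟩), by
        rw [hΨ, hE, RingEquiv.apply_symm_apply]⟩
    · exact ⟨_, Algebra.subset_adjoin (Or.inr ⟨i, hi, rfl⟩), hT i⟩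

end Hecke

end Algebras

end FormalHecke

end

open FormalHecke in
theorem lemma6p3 {R : Type*} [CommRing R] (F : FormalGroup R) [F.IsComm] (ha : IsUnit (a₁₁ F))
    {ι Λ Λ' : Type*} [Finite ι] [AddCommGroup Λ] [Module.Finite ℤ Λ]
    [AddCommGroup Λ'] [Module.Finite ℤ Λ'] (P : RootDatum ι Λ Λ') (b : P.Base)
    {Γ : Type*} [AddCommGroup Γ] [Module.Free ℤ Γ] (hΓ : Module.finrank ℤ Γ = 1)
    (γ : Γ) (hγ : Submodule.span ℤ {γ} = ⊤) :
    (∃ φ : FGA F Λ ≃+* FGA (normalization F ha) Λ,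
      IsSubstitution (RingEquiv.refl R) (fSeries F ha) φ ∧
      ∃ Φ : QW F P ≃+* QW (normalization F ha) P,
        (∀ (w : P.weylGroup) (u : FGA F Λ),
          Φ (SkewMonoidAlgebra.single w (algebraMap (FGA F Λ) (Q F P) u)) =
            SkewMonoidAlgebra.single w (algebraMap _ (Q (normalization F ha) P) (φ u))) ∧
        ∃ ΦD : D F P ≃+* D (normalization F ha) P,
          ∀ d : D F P, (ΦD d : QW (normalization F ha) P) = Φ d) ∧
    (∃ (φΓ : FGA F Γ ≃+* FGA (normalization F ha) Γ)
        (φ : FGA₂ F Γ Λ ≃+* FGA₂ (normalization F ha) Γ Λ)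
        (jΓ : FGA (normalization F ha) Γ ≃+* FGA (normalization F ha) Γ)
        (j : FGA₂ (normalization F ha) Γ Λ ≃+* FGA₂ (normalization F ha) Γ Λ),
      IsSubstitution (RingEquiv.refl R) (fSeries F ha) φΓ ∧
      IsSubstitution φΓ (PowerSeries.map (algebraMap R _) (fSeries F ha)) φ ∧
      IsSubstitution (RingEquiv.refl R) (formalInverse (normalization F ha)) jΓ ∧
      IsSubstitution jΓ
        (PowerSeries.map (algebraMap R _) (formalInverse (normalization F ha))) j ∧
      ∃ Ψ : QW' Γ F P ≃+* QW' Γ (normalization F ha) P,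
        (∀ (w : P.weylGroup) (u : FGA₂ F Γ Λ),
          Ψ (SkewMonoidAlgebra.single w (algebraMap (FGA₂ F Γ Λ) (Q' Γ F P) u)) =
            SkewMonoidAlgebra.single w
              (algebraMap _ (Q' Γ (normalization F ha) P) (j (φ u)))) ∧
        (∃ ΨH : H F P b γ ≃+* H (normalization F ha) P b γ,
          ∀ d : H F P b γ, (ΨH d : QW' Γ (normalization F ha) P) = Ψ d) ∧
        ∀ i ∈ b.support, Ψ (T F P γ i) = T (normalization F ha) P γ i) := by
  have hfX := associated_X (constantCoeff_fSeries F ha) (isUnit_coeff_one_fSeries F ha)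
  have hf := isFormalHom_fSeries F ha
  have hh := isFormalHom_hSeries F ha
  have hfh := fSeries_subst_hSeries F ha
  have hhf := hSeries_subst_fSeries F ha
  have hi := isFormalHom_formalInverse (normalization F ha)
  have hii := formalInverse_subst_formalInverse (normalization F ha)
  refine ⟨?_, ?_⟩
  · obtain ⟨φ, hφ⟩ := exists_isSubstitution_refl Λ hf hh hfh hhf
    exact ⟨φ, hφ, exists_demazure_ringEquiv P hfX hφ⟩
  · obtain ⟨φΓ, hφΓ⟩ := exists_isSubstitution_refl Γ hf hh hfh hhf
    obtain ⟨φ, hφ⟩ := exists_isSubstitution_baseChange Λ hf hh hfh hhf φΓ hφΓ.map_algebraMap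
    obtain ⟨jΓ, hjΓ⟩ := exists_isSubstitution_refl Γ hi hi hii hii
    obtain ⟨j, hj⟩ := exists_isSubstitution_baseChange Λ hi hi hii hii jΓ hjΓ.map_algebraMap
    refine ⟨φΓ, φ, jΓ, j, hφΓ, hφ, hjΓ, hj, ?_⟩
    have hi0 := constantCoeff_formalInverse (normalization F ha)
    have hΓ' : IsSubstitutionHom (RingHom.id R) (twist F ha)
        ((φΓ.trans jΓ : FGA F Γ ≃+* FGA (normalization F ha) Γ) :
          FGA F Γ →+* FGA (normalization F ha) Γ) := by
      have := hjΓ.isSubstitutionHom.comp hi0 hφΓ.isSubstitutionHom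
      rw [RingEquiv.coe_ringHom_refl, RingHom.id_comp, PowerSeries.map_id, id] at this
      exact this
    have hm : PowerSeries.map (jΓ : FGA (normalization F ha) Γ →+* _)
        (PowerSeries.map (algebraMap R _) (fSeries F ha)) =
          PowerSeries.map (algebraMap R (FGA (normalization F ha) Γ)) (fSeries F ha) := by
      rw [← RingHom.comp_apply, ← PowerSeries.map_comp]
      congr 2
      exact RingHom.ext hjΓ.map_algebraMap
    have hΛ : IsSubstitutionHom
        ((φΓ.trans jΓ : FGA F Γ ≃+* FGA (normalization F ha) Γ) :
          FGA F Γ →+* FGA (normalization F ha) Γ)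
        (PowerSeries.map (algebraMap R (FGA (normalization F ha) Γ)) (twist F ha))
        ((φ.trans j : FGA₂ F Γ Λ ≃+* FGA₂ (normalization F ha) Γ Λ) :
          FGA₂ F Γ Λ →+* FGA₂ (normalization F ha) Γ Λ) := by
      have := hj.isSubstitutionHom.comp
        (constantCoeff_powerSeries_map hi0 (algebraMap R (FGA (normalization F ha) Γ)))
        hφ.isSubstitutionHom
      rw [hm] at this
      have e := powerSeries_map_subst (τ := Unit) hi0
        (algebraMap R (FGA (normalization F ha) Γ)) (fSeries F ha)
      exact (show _ = _ from e) ▸ this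
    obtain ⟨Ψ, hΨ, hH, hT⟩ := exists_hecke_ringEquiv P b γ (constantCoeff_twist F ha)
      (isUnit_kappa F ha) (kappa_normalization F ha) (mu_subst_twist F ha)
      (kappa_subst_twist_mul F ha) (φΓ.trans jΓ) hΓ' (φ.trans j) hΛ
    exact ⟨Ψ, hΨ, hH, fun i _ => hT i⟩
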